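/- Fix $k\ge 1$, a probability vector $\pi=(\pi_a)_{a\in[k]}$ with all $\pi_a>0$, a symmetric matrix $B\in\mathbb R^{k\times k}$ with all $B_{ab}>0$, and probability distributions on $\mathbb R$ with cumulative distribution functions $F_{ab}=F_{ba}$ ($a,b\in[k]$), all independent of $n$. For each $n$ let $p_{ab}=B_{ab}\rho_n\in[0,1]$, where $\rho_n=\omega(n^{-1}\log n)$. Assume that each $F_{ab}$ is continuous with $F_{ab}(0)=0$ and right derivative $F_{ab}'(0)=\lambda_{ab}>0$. Let $(z,G)\sim\mathrm{wSBM}(n,\pi,p,F)$: each vertex $u\in[n]$ is independently put in block $z_u=a$ with probability $\pi_a$; given $z$, each pair $\{u,v\}$, $u\neq v$, is independently an edge of the undirected graph $G$ with probability $p_{z_uz_v}$, and each edge $\{u,v\}$ independently receives a cost $c(u,v)$ with cdf $F_{z_uz_v}$. Let $C(u,v)\in[0,\infty]$ be the minimal cost (sum of edge costs) of a path from $u$ to $v$ in $G$, with $C(u,v)=\infty$ if there is no such path. Put $\Lambda=(\lambda_{ab})$, $T=(\Lambda\odot B)\,\mathrm{diag}(\pi)$, where $\odot$ is the entrywise product,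 $\tau=T1_k$, where $1_k$ is the all-ones vector, and let $\tau_{\min},\tau_{\max}$ be the smallest and largest entries of $\tau$. Fix $a,b\in[k]$ and, given $(z,G)$, choose $u$ and $v$ independently and uniformly at random in blocks $a$ and $b$, respectively. Then, with probability tending to $1$ as $n\to\infty$, $$\frac{1+o(1)}{\tau_{\max}}\;\le\;\frac{n\rho_n}{\log n}\,C(u,v)\;\le\;\frac{1+o(1)}{\tau_{\min}},$$ that is, for every $\varepsilon>0$, $$\mathbb P\left(\frac{1-\varepsilon}{\tau_{\max}}\le\frac{n\rho_n}{\log n}\,C(u,v)\le\frac{1+\varepsilon}{\tau_{\min}}\right)\longrightarrow 1 .$$ (The event is taken to fail when block $a$ or block $b$ is empty, which has probability tending to $0$.) -/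

import Mathlib

open MeasureTheory ProbabilityTheory Filter Topology Asymptotics
open scoped ENNReal Matrix

noncomputable section

namespace WSBM

/-- The data of a random weighted graph on the vertex set `Fin n`: for every unordered pair `e`,
whether `e` is an edge, and its cost. The cost of a pair that is not an edge is never read, and
neither is anything at a diagonal pair `s(u, u)`. -/
abbrev GraphData (n : ℕ) : Type := Sym2 (Fin n) → Bool × ℝ

/-- The underlying undirected simple graph `([n], E)` (loops are discarded). -/
def GraphData.graph {n : ℕ} (g : GraphData n) : SimpleGraph (Fin n) :=
  SimpleGraph.fromEdgeSet {e | (g e).1 = true}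

/-- The cost `c(e)` of the pair `e`. -/
def GraphData.cost {n : ℕ} (g : GraphData n) (e : Sym2 (Fin n)) : ℝ := (g e).2

/-- The cost of a path: the sum of the costs of the edges that it traverses. -/
def GraphData.pathCost {n : ℕ} (g : GraphData n) {u v : Fin n} (w : g.graph.Walk u v) : ℝ≥0∞ :=
  (w.edges.map fun e => ENNReal.ofReal (g.cost e)).sum

/-- The cost `C(u, v)` of the shortest path from `u` to `v`; it is `∞` when there is no path. -/
def GraphData.shortestPathCost {n : ℕ} (g : GraphData n) (u v : Fin n) : ℝ≥0∞ :=
  ⨅ w : g.graph.Walk u v, g.pathCost w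

/-- The law of the data of one pair: it is an edge with probability `p`, and has a cost drawn from
the distribution `D` independently of that. -/
def pairLaw (p : ℝ) (D : Measure ℝ) : Measure (Bool × ℝ) :=
  (ENNReal.ofReal p • Measure.dirac true + ENNReal.ofReal (1 - p) • Measure.dirac false).prod D

/-- The conditional law of the weighted graph given the block assignment `z`: the pairs
`e = {u, v}`, `u < v`, are independent, with edge probability `p (z u) (z v)` and cost
distribution `F (z u) (z v)`. -/
def graphLaw {n k : ℕ} (p : Matrix (Fin k) (Fin k) ℝ) (F : Fin k → Fin k → Measure ℝ)
    (z : Fin n → Fin k) : Measure (GraphData n) :=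
  Measure.pi fun e : Sym2 (Fin n) => pairLaw (p (z e.inf) (z e.sup)) (F (z e.inf) (z e.sup))

/-- The weighted stochastic block model `wSBM(n, π, p, F)`: the joint law of the block assignment
`z`, which has probability `∏ u, π (z u)`, and of the weighted graph. -/
def wSBM {k : ℕ} (n : ℕ) (π : Fin k → ℝ) (p : Matrix (Fin k) (Fin k) ℝ)
    (F : Fin k → Fin k → Measure ℝ) : Measure ((Fin n → Fin k) × GraphData n) :=
  ∑ z : Fin n → Fin k,
    ENNReal.ofReal (∏ u, π (z u)) • (Measure.dirac z).prod (graphLaw p F z)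

/-- The probability that `A g u v` holds when `(z, g)` is drawn from `wSBM(n, π, p, F)` and then,
given `(z, g)`, the vertices `u` and `v` are drawn independently and uniformly from the blocks
`{u | z u = a}` and `{v | z v = b}`. An outcome with one of these blocks empty, where no choice is
possible, counts as a failure of `A`. -/
def probUniformInBlocks {k : ℕ} (n : ℕ) (π : Fin k → ℝ) (p : Matrix (Fin k) (Fin k) ℝ)
    (F : Fin k → Fin k → Measure ℝ) (a b : Fin k)
    (A : GraphData n → Fin n → Fin n → Prop) : ℝ≥0∞ :=
  ∫⁻ x, ((uniformOn {u | x.1 u = a}).prod (uniformOn {v | x.1 v = b})) {q | A x.2 q.1 q.2}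
    ∂(wSBM n π p F)

/-- The matrix `T = (Λ ⊙ B) diag(π)`. -/
def operatorT {k : ℕ} (Λ B : Matrix (Fin k) (Fin k) ℝ) (π : Fin k → ℝ) :
    Matrix (Fin k) (Fin k) ℝ :=
  (Λ ⊙ B) * Matrix.diagonal π

/-- The vector `τ = T 1_k`. -/
def tau {k : ℕ} (Λ B : Matrix (Fin k) (Fin k) ℝ) (π : Fin k → ℝ) : Fin k → ℝ :=
  operatorT Λ B π *ᵥ (fun _ => 1)

/-- The smallest entry of `τ`. -/
def tauMin {k : ℕ} (Λ B : Matrix (Fin k) (Fin k) ℝ) (π : Fin k → ℝ) : ℝ := ⨅ i, tau Λ B π i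

/-- The largest entry of `τ`. -/
def tauMax {k : ℕ} (Λ B : Matrix (Fin k) (Fin k) ℝ) (π : Fin k → ℝ) : ℝ := ⨆ i, tau Λ B π i

end WSBM

end

/-! Only small costs matter, and near 0 the cdf `F_ab` is linear with slope `λ_ab`. Hence a vertex
of block `a` reaches new vertices at rate about `nρτ_a`, and the ball around `u` grows at an
exponential rate between `nρτ_min` and `nρτ_max`. It meets `v` once it has size of order `n`.

Lower bound on `C(u,v)`: a first moment with Gibbs weights. Give a path the weight `exp (-θ ·
cost)`, with `θ` slightly above `nρτ_max`. The mean weights of the pairs at a vertex then sum to at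
most some `κ < 1` (`lintegral_edgeWeight_le`), so all self-avoiding paths from `u` have mean total
weight at most `1/(1-κ)` (`lintegral_sum_pathSum_le`). A vertex within distance `t` contributes at
least `exp (-θt)`. For `t = (1-ε) log n/(nρτ_max)` the mean number of such vertices is therefore
`O(n^(1-ε²))`, and a uniform vertex of a block of linear size is rarely one of them.

Upper bound: explore from `u` in `J` short time steps. Through its own cdf a cost is uniform, so its
hazard increases; whatever the past, each explored vertex finds a new one with hazard at least `η`
per step, where `ηJ` is about `nρτ_min t`. While the explored set has size `k`, the potential `Ψ k`,
roughly `(n/k)^β`, loses a fraction `β/k` with hazard `kη`; so it decays in mean by a factor of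
about `1 - βη` per step, uniformly in `k`. Once `k` is a small multiple of `n`, the pairs leading
directly to `v` have hazard at least `2βη` if `β` is small. So `v` is missed with probability at
most `2 n^β exp (-βηJ/(1+δ))` (`measureReal_missed_le_rpow_mul_exp`), which vanishes for `t = (1+ε)
log n/(nρτ_min)`. A small `β` suffices because only the exponent of `n` has to become negative.

Both bounds are proved for fixed balanced block assignments; by Chebyshev these have probability
tending to 1. -/

namespace WSBM

/-! ### Independence of disjoint coordinates under a product measure. -/

section Independence

variable {ι : Type*} [Fintype ι] {Ω : ι → Type*} [∀ i, MeasurableSpace (Ω i)]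

/-- Under a product measure, functions of disjoint sets of coordinates are uncorrelated. -/
theorem lintegral_mul_of_dependsOn (μ : ∀ i, Measure (Ω i)) [∀ i, IsProbabilityMeasure (μ i)]
    {s : Set ι} {f g : (∀ i, Ω i) → ℝ≥0∞} (hf : Measurable f) (hg : Measurable g)
    (hfs : DependsOn f s) (hgs : DependsOn g sᶜ) :
    ∫⁻ ω, f ω * g ω ∂Measure.pi μ = (∫⁻ ω, f ω ∂Measure.pi μ) * ∫⁻ ω, g ω ∂Measure.pi μ := by
  classical
  have hne : ∀ i, Nonempty (Ω i) := fun i => (μ i).nonempty_of_neZero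
  let ω₀ : ∀ i, Ω i := fun i => (hne i).some
  have hmp := measurePreserving_piEquivPiSubtypeProd μ (· ∈ s)
  set e := MeasurableEquiv.piEquivPiSubtypeProd Ω (· ∈ s) with he
  -- The missing coordinates are filled in arbitrarily; `DependsOn` makes the choice irrelevant.
  let f' : (∀ i : {i // i ∈ s}, Ω i) → ℝ≥0∞ := fun y => f (e.symm (y, fun i => ω₀ i))
  let g' : (∀ i : {i // i ∉ s}, Ω i) → ℝ≥0∞ := fun y => g (e.symm (fun i => ω₀ i, y))
  have hf' : Measurable f' := hf.comp (e.symm.measurable.comp (by fun_prop))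
  have hg' : Measurable g' := hg.comp (e.symm.measurable.comp (by fun_prop))
  have hfe : ∀ ω, f ω = f' (e ω).1 := fun ω => hfs fun i hi => by
    simp [e, MeasurableEquiv.piEquivPiSubtypeProd, Equiv.piEquivPiSubtypeProd, hi]
  have hge : ∀ ω, g ω = g' (e ω).2 := fun ω => hgs fun i hi => by
    have hi' : i ∉ s := hi
    simp [e, MeasurableEquiv.piEquivPiSubtypeProd, Equiv.piEquivPiSubtypeProd, hi']
  have h1 : ∫⁻ ω, f ω * g ω ∂Measure.pi μ = ∫⁻ y, f' y.1 * g' y.2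
      ∂((Measure.pi fun i : Subtype (· ∈ s) => μ i).prod
        (Measure.pi fun i : {i // i ∉ s} => μ i)) := by
    refine (lintegral_congr fun ω => by rw [hfe, hge]).trans (hmp.lintegral_comp
      (f := fun y => f' y.1 * g' y.2) ((hf'.comp measurable_fst).mul (hg'.comp measurable_snd)))
  have h2 : ∫⁻ ω, f ω ∂Measure.pi μ =
      ∫⁻ y, f' y ∂(Measure.pi fun i : Subtype (· ∈ s) => μ i) := by
    rw [← (measurePreserving_fst.comp hmp).lintegral_comp hf']
    exact lintegral_congr hfe
  have h3 : ∫⁻ ω, g ω ∂Measure.pi μ =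
      ∫⁻ y, g' y ∂(Measure.pi fun i : {i // i ∉ s} => μ i) := by
    rw [← (measurePreserving_snd.comp hmp).lintegral_comp hg']
    exact lintegral_congr hge
  rw [h1, h2, h3, lintegral_prod_mul hf'.aemeasurable hg'.aemeasurable]

/-- Under a product measure, events of disjoint sets of coordinates are independent. -/
theorem measureReal_inter_of_dependsOn (μ : ∀ i, Measure (Ω i)) [∀ i, IsProbabilityMeasure (μ i)]
    {s : Set ι} {A B : Set (∀ i, Ω i)} (hA : MeasurableSet A) (hB : MeasurableSet B)
    (hAs : DependsOn (· ∈ A) s) (hBs : DependsOn (· ∈ B) sᶜ) :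
    (Measure.pi μ).real (A ∩ B) = (Measure.pi μ).real A * (Measure.pi μ).real B := by
  classical
  have hind : ∀ {C : Set (∀ i, Ω i)} {t : Set ι}, DependsOn (· ∈ C) t →
      DependsOn (C.indicator (1 : (∀ i, Ω i) → ℝ≥0∞)) t := fun {C t} hC x y hxy => by
    have := hC hxy
    simp only [Set.indicator_apply]
    simp only [eq_iff_iff] at this
    simp [this]
  have h := lintegral_mul_of_dependsOn μ (measurable_one.indicator hA)
    (measurable_one.indicator hB) (hind hAs) (hind hBs)
  rw [lintegral_indicator_one hA, lintegral_indicator_one hB] at h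
  simp only [measureReal_def, ← ENNReal.toReal_mul, ← h]
  congr 1
  rw [← lintegral_indicator_one (hA.inter hB)]
  exact lintegral_congr fun ω => by simp [Set.inter_indicator_one]

end Independence

/-! ### Gibbs weights of self-avoiding paths. -/

section PathSums

variable {n : ℕ}

/-- The Gibbs weight `exp (-θ c)` of a pair that is an edge of cost `c`; other pairs have
weight `0`. -/
noncomputable def edgeWeight (θ : ℝ) (y : Bool × ℝ) : ℝ≥0∞ :=
  if y.1 = true then ENNReal.ofReal (Real.exp (-θ * max y.2 0)) else 0

/-- The total Gibbs weight of the self-avoiding paths of `m` steps from `u` to `w` whose vertices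
other than `u` avoid `A`. -/
noncomputable def pathSum (θ : ℝ) (g : GraphData n) : ℕ → Finset (Fin n) → Fin n → Fin n → ℝ≥0∞
  | 0, _, u, w => if u = w then 1 else 0
  | m + 1, A, u, w => ∑ x ∈ Aᶜ, edgeWeight θ (g s(u, x)) * pathSum θ g m (insert x A) x w

theorem measurable_edgeWeight (θ : ℝ) : Measurable (edgeWeight θ) := by
  unfold edgeWeight
  refine Measurable.ite (measurable_fst (measurableSet_singleton true)) ?_ measurable_const
  fun_prop

theorem measurable_pathSum (θ : ℝ) (m : ℕ) (A : Finset (Fin n)) (u w : Fin n) :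
    Measurable fun g : GraphData n => pathSum θ g m A u w := by
  induction m generalizing A u with
  | zero => exact measurable_const
  | succ m ih =>
    simp only [pathSum]
    refine Finset.measurable_sum _ fun x _ => Measurable.mul ?_ (ih _ _)
    exact (measurable_edgeWeight θ).comp (measurable_pi_apply _)

/-- Each step enters a vertex outside `A`, so pairs inside `A` are never read. This makes the first
step of a path independent of the rest. -/
theorem dependsOn_pathSum (θ : ℝ) (m : ℕ) (A : Finset (Fin n)) (u w : Fin n) :
    DependsOn (fun g : GraphData n => pathSum θ g m A u w) {e | ∃ y ∈ e, y ∉ A} := by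
  induction m generalizing A u with
  | zero => intro g g' _; rfl
  | succ m ih =>
    intro g g' h
    simp only [pathSum]
    refine Finset.sum_congr rfl fun x hx => ?_
    rw [h s(u, x) ⟨x, by simp, by simpa using hx⟩]
    congr 1
    refine ih _ _ fun e he => h e ?_
    obtain ⟨y, hy, hyA⟩ := he
    exact ⟨y, hy, fun hA => hyA (Finset.mem_insert_of_mem hA)⟩

/-- The expected weight of the self-avoiding paths of `m` steps from a vertex. -/
theorem lintegral_sum_pathSum_le (θ : ℝ) (μ : Sym2 (Fin n) → Measure (Bool × ℝ))
    [∀ e, IsProbabilityMeasure (μ e)] {r : ℝ≥0∞}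
    (hr : ∀ u, ∑ x, ∫⁻ y, edgeWeight θ y ∂μ s(u, x) ≤ r) (m : ℕ) (A : Finset (Fin n))
    (u : Fin n) (hu : u ∈ A) :
    ∫⁻ g : GraphData n, ∑ w, pathSum θ g m A u w ∂Measure.pi μ ≤ r ^ m := by
  induction m generalizing A u with
  | zero => simp [pathSum]
  | succ m ih =>
    have hswap : ∀ g : GraphData n, ∑ w, pathSum θ g (m + 1) A u w =
        ∑ x ∈ Aᶜ, edgeWeight θ (g s(u, x)) * ∑ w, pathSum θ g m (insert x A) x w := fun g => by
      simp only [pathSum, Finset.mul_sum]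
      rw [Finset.sum_comm]
    have hmeas : ∀ x, Measurable fun g : GraphData n => edgeWeight θ (g s(u, x)) := fun x =>
      (measurable_edgeWeight θ).comp (measurable_pi_apply _)
    have hmeas' : ∀ x, Measurable fun g : GraphData n =>
        ∑ w, pathSum θ g m (insert x A) x w := fun x =>
      Finset.measurable_sum _ fun w _ => measurable_pathSum θ m _ _ w
    simp only [hswap]
    rw [lintegral_finsetSum (f := fun x (g : GraphData n) => edgeWeight θ (g s(u, x)) *
      ∑ w, pathSum θ g m (insert x A) x w) _ fun x _ => (hmeas x).mul (hmeas' x)]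
    calc ∑ x ∈ Aᶜ, ∫⁻ g : GraphData n, edgeWeight θ (g s(u, x)) *
            ∑ w, pathSum θ g m (insert x A) x w ∂Measure.pi μ
        ≤ ∑ x ∈ Aᶜ, (∫⁻ y, edgeWeight θ y ∂μ s(u, x)) * r ^ m := by
          refine Finset.sum_le_sum fun x _ => ?_
          -- Both ends of `s(u, x)` lie in `insert x A`, so the remaining path does not read this
          -- pair.
          rw [lintegral_mul_of_dependsOn μ (s := {s(u, x)}) (hmeas x) (hmeas' x)]
          · refine mul_le_mul' (le_of_eq ?_) (ih _ _ (Finset.mem_insert_self _ _))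
            exact (measurePreserving_eval μ s(u, x)).lintegral_comp (measurable_edgeWeight θ)
          · intro g g' h
            simp only [h s(u, x) rfl]
          · intro g g' h
            refine Finset.sum_congr rfl fun w _ => dependsOn_pathSum θ m _ _ w fun e he => h e ?_
            rintro rfl
            obtain ⟨y, hy, hyA⟩ := he
            rcases Sym2.mem_iff.1 hy with rfl | rfl
            · exact hyA (Finset.mem_insert_of_mem hu)
            · exact hyA (Finset.mem_insert_self _ _)
      _ ≤ (∑ x, ∫⁻ y, edgeWeight θ y ∂μ s(u, x)) * r ^ m := by
          rw [← Finset.sum_mul]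
          gcongr
          exact Finset.subset_univ _
      _ ≤ r ^ (m + 1) := by
          rw [pow_succ']
          gcongr
          exact hr u

/-- The weights along a path multiply to the exponential of its cost, and the path is one term of
the sum. The start may lie in `A`, since only later vertices have to avoid it. -/
theorem exp_le_pathSum_of_isPath (θ : ℝ) (g : GraphData n) {u v : Fin n}
    (p : g.graph.Walk u v) (hp : p.IsPath) (A : Finset (Fin n))
    (hA : ∀ x ∈ p.support, x ∈ A → x = u) :
    ENNReal.ofReal (Real.exp (-θ * (p.edges.map fun e => max (g.cost e) 0).sum)) ≤
      pathSum θ g p.length A u v := by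
  induction p generalizing A with
  | nil => simp [pathSum]
  | @cons u x v h p ih =>
    rw [SimpleGraph.Walk.cons_isPath_iff] at hp
    have hedge : (g s(u, x)).1 = true := by
      have := h
      simp only [GraphData.graph, SimpleGraph.fromEdgeSet_adj] at this
      exact this.1
    have hx : x ∈ Aᶜ := by
      rw [Finset.mem_compl]
      intro hxA
      exact h.ne' (hA x (by simp) hxA)
    have hstep := ih hp.1 (insert x A) fun y hy hyA => by
      rcases Finset.mem_insert.1 hyA with rfl | hyA
      · rfl
      · exact absurd (hA y (by simp [hy]) hyA ▸ hy) hp.2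
    simp only [SimpleGraph.Walk.edges_cons, List.map_cons, List.sum_cons,
      SimpleGraph.Walk.length_cons, pathSum]
    refine le_trans ?_ (Finset.single_le_sum (f := fun x => edgeWeight θ (g s(u, x)) *
      pathSum θ g p.length (insert x A) x v) (fun _ _ => zero_le) hx)
    rw [mul_add, Real.exp_add, ENNReal.ofReal_mul (Real.exp_nonneg _)]
    refine mul_le_mul' ?_ hstep
    simp [edgeWeight, hedge, GraphData.cost]

/-- If `C(u, v) < t` then the paths from `u` to `v` have total weight at least `exp (-θ t)`. -/
theorem exp_le_pathSum_of_shortestPathCost_lt {θ : ℝ} (hθ : 0 ≤ θ) (g : GraphData n)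
    {u v : Fin n} {t : ℝ} (h : g.shortestPathCost u v < ENNReal.ofReal t) :
    ENNReal.ofReal (Real.exp (-θ * t)) ≤ ∑ m ∈ Finset.range n, pathSum θ g m {u} u v := by
  obtain ⟨w, hw⟩ := iInf_lt_iff.1 h
  -- Bypassing cycles leaves a sublist of the edges, so the cost does not increase.
  have hcost : ENNReal.ofReal ((w.bypass.edges.map fun e => max (g.cost e) 0).sum) ≤
      g.pathCost w := by
    have : ∀ l : List (Sym2 (Fin n)), ENNReal.ofReal ((l.map fun e => max (g.cost e) 0).sum) =
        (l.map fun e => ENNReal.ofReal (g.cost e)).sum := fun l => by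
      induction l with
      | nil => simp
      | cons e l ih =>
        simp only [List.map_cons, List.sum_cons]
        rw [ENNReal.ofReal_add (le_max_right _ _)
          (List.sum_nonneg (by simp)), ih]
        congr 1
        rcases le_total (g.cost e) 0 with hc | hc
        · simp [hc, ENNReal.ofReal_of_nonpos hc]
        · simp [hc]
    rw [this]
    exact (w.edges_bypass_sublist_edges.map _).sum_le_sum (by simp)
  have ht := (ENNReal.ofReal_lt_ofReal_iff').1 (hcost.trans_lt hw)
  have hlen : w.bypass.length < n := by
    simpa using (w.bypass_isPath).length_lt
  refine le_trans ?_ ((exp_le_pathSum_of_isPath θ g w.bypass w.bypass_isPath {u} (by simp)).trans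
    (Finset.single_le_sum (f := fun m => pathSum θ g m {u} u v) (fun _ _ => zero_le)
      (Finset.mem_range.2 hlen)))
  refine ENNReal.ofReal_le_ofReal (Real.exp_le_exp.2 ?_)
  nlinarith [ht.1]

end PathSums

/-! ### Discrete-time exploration and its supermartingale bound. -/

section Exploration

variable {V : Type*} {Ω : Type*}

/-- The event that each pair `{w, x}` with `w ∈ S` and `x ∉ S` takes more than `a w + b x` steps
to traverse. -/
def cutSurvives (H : Sym2 V → ℕ → Set Ω) (S : Finset V) (a b : V → ℕ) : Set (Sym2 V → Ω) :=
  {ω | ∀ w ∈ S, ∀ x ∉ S, ω s(w, x) ∈ H s(w, x) (a w + b x)}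

variable {H : Sym2 V → ℕ → Set Ω}

/-- This and the next two `DependsOn` lemmas give the Markov property: the past reads only pairs
inside the explored set `T`, while the survival of the cut and the future read only the other pairs.
-/
theorem dependsOn_cutSurvives (S : Finset V) (a b : V → ℕ) :
    DependsOn (· ∈ cutSurvives H S a b) {e | ∃ y ∈ e, y ∉ S} := by
  intro ω ω' h
  simp only [cutSurvives, Set.mem_ofPred_eq, eq_iff_iff]
  refine forall₂_congr fun w _ => forall₂_congr fun x hx => ?_
  rw [h s(w, x) ⟨x, by simp, hx⟩]

theorem measurable_mem_pair [MeasurableSpace Ω] (hH : ∀ e j, MeasurableSet (H e j)) (e : Sym2 V)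
    (j : ℕ) :
    Measurable fun ω : Sym2 V → Ω => ω e ∈ H e j :=
  measurableSet_setOfPred.1 (measurable_pi_apply e (hH e j))

theorem measurableSet_cutSurvives [MeasurableSpace Ω] [Countable V]
    (hH : ∀ e j, MeasurableSet (H e j)) (S : Finset V) (a b : V → ℕ) : MeasurableSet (cutSurvives H S a b) :=
  measurableSet_setOfPred.2 (Measurable.forall fun _ => Measurable.imp measurable_const
    (Measurable.forall fun _ => Measurable.imp measurable_const (measurable_mem_pair hH _ _)))

variable [DecidableEq V]

/-- The event that each vertex of `T \ S` is reached from `S` in exactly one more step. -/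
def reachedNow (H : Sym2 V → ℕ → Set Ω) (S T : Finset V) (a : V → ℕ) : Set (Sym2 V → Ω) :=
  {ω | ∀ x ∈ T \ S, (∀ w ∈ S, ω s(w, x) ∈ H s(w, x) (a w)) ∧
    ∃ w ∈ S, ω s(w, x) ∉ H s(w, x) (a w + 1)}

theorem dependsOn_reachedNow {S T : Finset V} (hST : S ⊆ T) (a : V → ℕ) :
    DependsOn (· ∈ reachedNow H S T a) {e | ∃ y ∈ e, y ∉ T}ᶜ := by
  intro ω ω' h
  have hmem : ∀ w ∈ S, ∀ x ∈ T, ω s(w, x) = ω' s(w, x) := fun w hw x hx => h _ <| by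
    rintro ⟨y, hy, hyT⟩
    rcases Sym2.mem_iff.1 hy with rfl | rfl
    · exact hyT (hST hw)
    · exact hyT hx
  simp only [reachedNow, Set.mem_ofPred_eq, eq_iff_iff]
  refine forall₂_congr fun x hx => ?_
  have hxT := (Finset.mem_sdiff.1 hx).1
  refine and_congr (forall₂_congr fun w hw => by rw [hmem w hw x hxT]) ?_
  exact exists_congr fun w => and_congr_right fun hw => by rw [hmem w hw x hxT]

variable [Fintype V]

open Classical in
/-- One time step of the exploration: the vertices reached from `S`, when `w ∈ S` has been explored
for `a w` steps and `H e j` is the set of values for which the pair `e` takes more than `j` steps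
to traverse. -/
noncomputable def nextReached (H : Sym2 V → ℕ → Set Ω) (S : Finset V) (a : V → ℕ)
    (ω : Sym2 V → Ω) : Finset V :=
  S ∪ Finset.univ.filter fun x => x ∉ S ∧ ∃ w ∈ S, ω s(w, x) ∉ H s(w, x) (a w + 1)

/-- The exploration ages after one more time step. -/
def nextAge (S : Finset V) (a : V → ℕ) (w : V) : ℕ := if w ∈ S then a w + 1 else 0

/-- The event that the exploration started from `S` with ages `a` has not reached `v` after a
given number of steps. -/
def missed (H : Sym2 V → ℕ → Set Ω) (v : V) : ℕ → Finset V → (V → ℕ) → Set (Sym2 V → Ω)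
  | 0, S, _ => {_ω | v ∉ S}
  | j + 1, S, a => {ω | v ∉ S ∧ ω ∈ missed H v j (nextReached H S a ω) (nextAge S a)}

theorem mem_nextReached {S : Finset V} {a : V → ℕ} {ω : Sym2 V → Ω} {x : V} :
    x ∈ nextReached H S a ω ↔ x ∈ S ∨ ∃ w ∈ S, ω s(w, x) ∉ H s(w, x) (a w + 1) := by
  simp only [nextReached, Finset.mem_union, Finset.mem_filter, Finset.mem_univ, true_and]
  tauto

theorem subset_nextReached (S : Finset V) (a : V → ℕ) (ω : Sym2 V → Ω) :
    S ⊆ nextReached H S a ω := fun _ hx => mem_nextReached.2 (Or.inl hx)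

theorem nextReached_congr {S : Finset V} {a : V → ℕ} {ω ω' : Sym2 V → Ω}
    (h : ∀ e, (∃ y ∈ e, y ∉ S) → ω e = ω' e) : nextReached H S a ω = nextReached H S a ω' := by
  ext x
  rw [mem_nextReached, mem_nextReached]
  by_cases hx : x ∈ S
  · simp [hx]
  · simp only [hx, false_or]
    exact exists_congr fun w => and_congr_right fun _ => by rw [h s(w, x) ⟨x, by simp, hx⟩]

theorem dependsOn_missed (v : V) (j : ℕ) (S : Finset V) (a : V → ℕ) :
    DependsOn (· ∈ missed H v j S a) {e | ∃ y ∈ e, y ∉ S} := by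
  induction j generalizing S a with
  | zero => intro ω ω' _; rfl
  | succ j ih =>
    intro ω ω' h
    simp only [missed, Set.mem_ofPred_eq]
    rw [nextReached_congr h]
    congr 1
    refine ih _ _ fun e he => h e ?_
    obtain ⟨y, hy, hyS⟩ := he
    exact ⟨y, hy, fun hS => hyS (subset_nextReached S a ω' hS)⟩

/-- One step of the exploration: the pairs not inside `T` only have to survive the new ages. -/
theorem nextReached_eq_inter_cutSurvives (hH0 : ∀ e, H e 0 = Set.univ)
    (hanti : ∀ e, Antitone (H e)) {S T : Finset V} (hST : S ⊆ T) (a : V → ℕ) :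
    {ω | nextReached H S a ω = T} ∩ cutSurvives H S a 0 =
      reachedNow H S T a ∩ cutSurvives H T (nextAge S a) 0 := by
  ext ω
  simp only [Set.mem_inter_iff, Set.mem_ofPred_eq, cutSurvives, reachedNow, Pi.zero_apply, add_zero,
    Finset.mem_sdiff]
  constructor
  · rintro ⟨hT, hS⟩
    refine ⟨fun x hx => ⟨fun w hw => hS w hw x hx.2, ?_⟩, fun w hw x hx => ?_⟩
    · rw [← hT] at hx
      exact (mem_nextReached.1 hx.1).resolve_left hx.2
    · by_cases hwS : w ∈ S
      · rw [← hT, mem_nextReached, not_or] at hx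
        simp only [nextAge, hwS, if_true]
        by_contra hcon
        exact hx.2 ⟨w, hwS, hcon⟩
      -- A newly reached vertex has age 0, at which nothing is required of its pairs.
      · simp [nextAge, hwS, hH0]
  · rintro ⟨hT, hcut⟩
    have hcut' : ∀ w ∈ S, ∀ x ∉ T, ω s(w, x) ∈ H s(w, x) (a w + 1) := fun w hw x hx => by
      simpa [nextAge, hw] using hcut w (hST hw) x hx
    refine ⟨?_, fun w hw x hx => ?_⟩
    · ext x
      rw [mem_nextReached]
      constructor
      · rintro (hx | ⟨w, hw, hx⟩)
        · exact hST hx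
        · by_contra hxT
          exact hx (hcut' w hw x hxT)
      · intro hx
        by_cases hxS : x ∈ S
        · exact Or.inl hxS
        · exact Or.inr (hT x ⟨hx, hxS⟩).2
    · by_cases hxT : x ∈ T
      · exact (hT x ⟨hxT, hx⟩).1 w hw
      · exact hanti _ (Nat.le_succ _) (hcut' w hw x hxT)

variable [MeasurableSpace Ω]

theorem measurableSet_nextReached_eq (hH : ∀ e j, MeasurableSet (H e j)) (S T : Finset V)
    (a : V → ℕ) : MeasurableSet {ω | nextReached H S a ω = T} := by
  have : {ω | nextReached H S a ω = T} = {ω | ∀ x, x ∈ T ↔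
      (x ∈ S ∨ ∃ w, w ∈ S ∧ ¬ ω s(w, x) ∈ H s(w, x) (a w + 1))} := by
    ext ω
    simp only [Set.mem_ofPred_eq, ← mem_nextReached, Finset.ext_iff, iff_comm]
  rw [this]
  refine measurableSet_setOfPred.2 (Measurable.forall fun x => measurable_const.iff
    (measurable_const.or (Measurable.exists fun w => measurable_const.and
      (measurable_mem_pair hH _ _).not)))

theorem measurableSet_missed (hH : ∀ e j, MeasurableSet (H e j)) (v : V) (j : ℕ) (S : Finset V)
    (a : V → ℕ) : MeasurableSet (missed H v j S a) := by
  induction j generalizing S a with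
  | zero => exact MeasurableSet.const _
  | succ j ih =>
    have : missed H v (j + 1) S a = {_ω | v ∉ S} ∩ ⋃ T : Finset V,
        ({ω | nextReached H S a ω = T} ∩ missed H v j T (nextAge S a)) := by
      ext ω
      simp [missed]
    rw [this]
    exact (MeasurableSet.const _).inter (MeasurableSet.iUnion fun T =>
      (measurableSet_nextReached_eq hH S T a).inter (ih _ _))

theorem measurableSet_reachedNow (hH : ∀ e j, MeasurableSet (H e j)) (S T : Finset V)
    (a : V → ℕ) : MeasurableSet (reachedNow H S T a) :=
  measurableSet_setOfPred.2 (Measurable.forall fun _ => Measurable.imp measurable_const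
    ((Measurable.forall fun _ => Measurable.imp measurable_const (measurable_mem_pair hH _ _)).and
      (Measurable.exists fun _ => measurable_const.and (measurable_mem_pair hH _ _).not)))

/-- If each survived step has hazard at least `q e`, then the probability that the pairs between
`S` and `X` survive one more step is at most `exp (-∑ q)`. -/
theorem measureReal_cutSurvives_le (μ : Sym2 V → Measure Ω) [∀ e, IsProbabilityMeasure (μ e)]
    {q : Sym2 V → ℝ} {J : ℕ}
    (hq : ∀ e j, j < J → (μ e).real (H e (j + 1)) ≤ Real.exp (-q e) * (μ e).real (H e j))
    {S X : Finset V} (hX : Disjoint S X) {a : V → ℕ} (ha : ∀ w ∈ S, a w < J) :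
    (Measure.pi μ).real (cutSurvives H S a fun x => if x ∈ X then 1 else 0) ≤
      Real.exp (-∑ w ∈ S, ∑ x ∈ X, q s(w, x)) * (Measure.pi μ).real (cutSurvives H S a 0) := by
  -- Written as a box over the pairs, the event has a probability that factorizes.
  have hpi : ∀ b : V → ℕ, cutSurvives H S a b = Set.univ.pi fun e =>
      {y | ∀ w ∈ S, ∀ x ∉ S, e = s(w, x) → y ∈ H e (a w + b x)} := fun b => by
    ext ω
    simp only [cutSurvives, Set.mem_ofPred_eq, Set.mem_univ_pi]
    exact ⟨fun h e w hw x hx he => he ▸ h w hw x hx, fun h w hw x hx => h _ w hw x hx rfl⟩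
  have hsum : ∑ w ∈ S, ∑ x ∈ X, q s(w, x) =
      ∑ e, ∑ w ∈ S, ∑ x ∈ X, if e = s(w, x) then q e else 0 := by
    rw [Finset.sum_comm (s := Finset.univ)]
    refine Finset.sum_congr rfl fun w _ => ?_
    rw [Finset.sum_comm (s := Finset.univ)]
    exact Finset.sum_congr rfl fun x _ => by simp
  rw [hpi, hpi, measureReal_def, measureReal_def, Measure.pi_pi, Measure.pi_pi, ENNReal.toReal_prod,
    ENNReal.toReal_prod, hsum, ← Finset.sum_neg_distrib, Real.exp_sum, ← Finset.prod_mul_distrib]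
  refine Finset.prod_le_prod (fun _ _ => ENNReal.toReal_nonneg) fun e _ => ?_
  by_cases he : ∃ w ∈ S, ∃ x ∉ S, e = s(w, x)
  · obtain ⟨w, hw, x, hx, rfl⟩ := he
    -- A pair crossing the cut determines which end is in `S`, so its hazard is counted once.
    have huniq : ∀ w' ∈ S, ∀ x' ∉ S, s(w, x) = s(w', x') ↔ w' = w ∧ x' = x := by
      intro w' hw' x' hx'
      rw [Sym2.eq_iff]
      constructor
      · rintro (⟨rfl, rfl⟩ | ⟨rfl, rfl⟩)
        · exact ⟨rfl, rfl⟩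
        · exact absurd hw hx'
      · rintro ⟨rfl, rfl⟩
        exact Or.inl ⟨rfl, rfl⟩
    have hset : ∀ b : V → ℕ, {y | ∀ w' ∈ S, ∀ x' ∉ S, s(w, x) = s(w', x') →
        y ∈ H s(w, x) (a w' + b x')} = H s(w, x) (a w + b x) := fun b => by
      ext y
      refine ⟨fun h => h w hw x hx rfl, fun h w' hw' x' hx' hee => ?_⟩
      obtain ⟨rfl, rfl⟩ := (huniq w' hw' x' hx').1 hee
      exact h
    have hq' : (∑ w' ∈ S, ∑ x' ∈ X, if s(w, x) = s(w', x') then q s(w, x) else 0) =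
        if x ∈ X then q s(w, x) else 0 := by
      have : ∀ w' ∈ S, ∀ x' ∈ X, (if s(w, x) = s(w', x') then q s(w, x) else 0) =
          if w' = w then (if x' = x then q s(w, x) else 0) else 0 := fun w' hw' x' hx' => by
        rw [if_congr (huniq w' hw' x' fun h => (Finset.disjoint_left.1 hX h) hx') rfl rfl, ite_and]
      rw [Finset.sum_congr rfl fun w' hw' => Finset.sum_congr rfl (this w' hw')]
      simp [Finset.sum_ite_eq', hw]
    rw [hset, hset, hq']
    by_cases hxX : x ∈ X
    · simpa [hxX, measureReal_def] using hq s(w, x) (a w) (ha w hw)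
    · simp [hxX]
  · have hq' : (∑ w' ∈ S, ∑ x' ∈ X, if e = s(w', x') then q e else 0) = 0 :=
      Finset.sum_eq_zero fun w' hw' => Finset.sum_eq_zero fun x' hx' => if_neg fun h =>
        he ⟨w', hw', x', fun h' => (Finset.disjoint_left.1 hX h') hx', h⟩
    have hset : ∀ b : V → ℕ, {y | ∀ w' ∈ S, ∀ x' ∉ S, e = s(w', x') →
        y ∈ H e (a w' + b x')} = Set.univ := fun b => Set.eq_univ_of_forall fun y w' hw' x' hx' h =>
      absurd ⟨w', hw', x', hx', h⟩ he
    rw [hset, hset, hq']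
    simp

/-- The exploration has not reached `v` after `j` steps with probability at most `Ψ |S| γ ^ j`,
as soon as `Ψ |S|` decreases in mean by the factor `γ` in each step that misses `v`. -/
theorem measureReal_missed_le (hH : ∀ e j, MeasurableSet (H e j)) (hH0 : ∀ e, H e 0 = Set.univ)
    (hanti : ∀ e, Antitone (H e)) (μ : Sym2 V → Measure Ω) [∀ e, IsProbabilityMeasure (μ e)]
    {q : Sym2 V → ℝ} {J : ℕ}
    (hq : ∀ e j, j < J → (μ e).real (H e (j + 1)) ≤ Real.exp (-q e) * (μ e).real (H e j))
    {v : V} {Ψ : ℕ → ℝ} (hΨ : Antitone Ψ) (hΨ1 : ∀ k ≤ Fintype.card V, 1 ≤ Ψ k) {γ : ℝ}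
    (hγ : 0 ≤ γ)
    (hstep : ∀ S : Finset V, S.Nonempty → v ∉ S →
      Real.exp (-∑ w ∈ S, ∑ x ∈ Sᶜ, q s(w, x)) * (Ψ S.card - Ψ (S.card + 1)) + Ψ (S.card + 1) ≤
        γ * Ψ S.card ∨ Real.exp (-∑ w ∈ S, q s(w, v)) ≤ γ)
    (j : ℕ) (S : Finset V) (hS : S.Nonempty) (a : V → ℕ) (ha : ∀ w, a w + j ≤ J) :
    (Measure.pi μ).real (cutSurvives H S a 0 ∩ missed H v j S a) ≤
      (Measure.pi μ).real (cutSurvives H S a 0) * Ψ S.card * γ ^ j := by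
  have hΨS : ∀ S : Finset V, 1 ≤ Ψ S.card := fun S => hΨ1 _ S.card_le_univ
  induction j generalizing S a with
  | zero =>
    rw [pow_zero, mul_one]
    refine (measureReal_mono Set.inter_subset_left).trans ?_
    exact le_mul_of_one_le_right measureReal_nonneg (hΨS S)
  | succ j ih =>
    set P := Measure.pi μ with hP
    set E := cutSurvives H S a 0 with hE
    by_cases hv : v ∈ S
    · have : E ∩ missed H v (j + 1) S a = ∅ := by
        ext ω
        simp [missed, hv]
      rw [this, measureReal_empty]
      have := hΨS S
      positivity
    have haJ : ∀ w ∈ S, a w < J := fun w _ => by have := ha w; omega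
    let N : Finset V → Set (Sym2 V → Ω) := fun T => {ω | nextReached H S a ω = T}
    have hNm : ∀ T, MeasurableSet (N T) := fun T => measurableSet_nextReached_eq hH S T a
    have hEm : MeasurableSet E := measurableSet_cutSurvives hH S a 0
    let 𝓣 : Finset (Finset V) := Finset.univ.filter fun T => S ⊆ T ∧ v ∉ T
    have hST : S ∈ 𝓣 := by simp [𝓣, hv]
    have hcover : E ∩ missed H v (j + 1) S a ⊆
        ⋃ T ∈ 𝓣, (N T ∩ E) ∩ missed H v j T (nextAge S a) := by
      rintro ω ⟨hωE, -, hω⟩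
      simp only [Set.mem_iUnion]
      refine ⟨nextReached H S a ω, ?_, ⟨rfl, hωE⟩, hω⟩
      simp only [𝓣, Finset.mem_filter, Finset.mem_univ, true_and]
      refine ⟨subset_nextReached S a ω, fun hmem => ?_⟩
      cases j with
      | zero => exact hω hmem
      | succ j => exact hω.1 hmem
    -- The event splits into a part inside `T` and the cut event of `T` with the new ages. By
    -- independence the induction hypothesis applies to the second part, and the two factors
    -- recombine to `P.real (N T ∩ E)`.
    have hterm : ∀ T ∈ 𝓣, P.real ((N T ∩ E) ∩ missed H v j T (nextAge S a)) ≤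
        P.real (N T ∩ E) * Ψ T.card * γ ^ j := by
      intro T hT
      have hsub : S ⊆ T := (Finset.mem_filter.1 hT).2.1
      have hdep : DependsOn
          (· ∈ cutSurvives H T (nextAge S a) 0 ∩ missed H v j T (nextAge S a))
          {e | ∃ y ∈ e, y ∉ T}ᶜᶜ := by
        rw [compl_compl]
        intro ω ω' h
        have h1 := dependsOn_cutSurvives (H := H) T (nextAge S a) 0 h
        have h2 := dependsOn_missed (H := H) v j T (nextAge S a) h
        simp only [Set.mem_inter_iff] at h1 h2 ⊢
        rw [h1, h2]
      rw [nextReached_eq_inter_cutSurvives hH0 hanti hsub, Set.inter_assoc,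
        measureReal_inter_of_dependsOn μ (measurableSet_reachedNow hH S T a)
          ((measurableSet_cutSurvives hH _ _ _).inter (measurableSet_missed hH _ _ _ _))
          (dependsOn_reachedNow hsub a) hdep,
        measureReal_inter_of_dependsOn μ (measurableSet_reachedNow hH S T a)
          (measurableSet_cutSurvives hH _ _ _) (dependsOn_reachedNow hsub a)
          (by rw [compl_compl]; exact dependsOn_cutSurvives _ _ _), mul_assoc, mul_assoc]
      refine mul_le_mul_of_nonneg_left ?_ measureReal_nonneg
      rw [← mul_assoc]
      refine ih T (hS.mono hsub) _ fun w => ?_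
      have := ha w
      simp only [nextAge]
      split_ifs <;> omega
    have hdisj : Set.PairwiseDisjoint (↑𝓣 : Set (Finset V)) fun T => N T ∩ E := by
      intro T _ T' _ hne
      refine Set.disjoint_left.2 fun ω h h' => hne ?_
      exact h.1.symm.trans h'.1
    have hsumT : ∑ T ∈ 𝓣, P.real (N T ∩ E) ≤ P.real E := by
      rw [← measureReal_biUnion_finset hdisj fun T _ => (hNm T).inter hEm]
      exact measureReal_mono (Set.iUnion₂_subset fun T _ => Set.inter_subset_right)
    have hmain : ∑ T ∈ 𝓣, P.real (N T ∩ E) * Ψ T.card ≤ P.real E * (γ * Ψ S.card) := by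
      rcases hstep S hS hv with hA | hB
      -- Small explored sets: either all pairs leaving `S` survive one more step, or the potential
      -- drops to at most `Ψ (S.card + 1)`.
      · have hstay : P.real (N S ∩ E) ≤
            Real.exp (-∑ w ∈ S, ∑ x ∈ Sᶜ, q s(w, x)) * P.real E := by
          refine (measureReal_mono ?_).trans
            (measureReal_cutSurvives_le μ hq (disjoint_compl_right (a := S)) haJ)
          rintro ω ⟨hω, -⟩ w hw x hx
          have hx' : x ∉ nextReached H S a ω := by rw [hω]; exact hx
          rw [mem_nextReached, not_or] at hx'
          by_contra hcon
          exact hx'.2 ⟨w, hw, by simpa [hx] using hcon⟩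
        have hother : ∀ T ∈ 𝓣.erase S, P.real (N T ∩ E) * Ψ T.card ≤
            P.real (N T ∩ E) * Ψ (S.card + 1) := by
          intro T hT
          refine mul_le_mul_of_nonneg_left (hΨ ?_) measureReal_nonneg
          have hTS := Finset.mem_erase.1 hT
          have hsub : S ⊂ T := (Finset.ssubset_iff_subset_ne).2
            ⟨(Finset.mem_filter.1 hTS.2).2.1, hTS.1.symm⟩
          exact Finset.card_lt_card hsub
        have hle := Finset.sum_le_sum hother
        rw [← Finset.sum_mul] at hle
        have hadd := Finset.add_sum_erase 𝓣 (fun T => P.real (N T ∩ E)) hST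
        have hadd' := Finset.add_sum_erase 𝓣 (fun T => P.real (N T ∩ E) * Ψ T.card) hST
        rw [← hadd']
        have hd : 0 ≤ Ψ S.card - Ψ (S.card + 1) := sub_nonneg.2 (hΨ (Nat.le_succ _))
        have h1 : ∑ T ∈ 𝓣.erase S, P.real (N T ∩ E) ≤ P.real E - P.real (N S ∩ E) := by linarith
        have hpos : 0 ≤ Ψ (S.card + 1) := by
          have hlt : S.card < Fintype.card V := Finset.card_lt_univ_of_notMem hv
          linarith [hΨ1 (S.card + 1) hlt]
        have h2 := mul_le_mul_of_nonneg_right h1 hpos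
        have h3 := mul_le_mul_of_nonneg_right hstay hd
        have h4 := mul_le_mul_of_nonneg_left hA (measureReal_nonneg (μ := P) (s := E))
        nlinarith
      -- Large explored sets: missing `v` in this step already costs the factor `γ`, so monotonicity
      -- of `Ψ` is enough.
      · have hmiss : ∑ T ∈ 𝓣, P.real (N T ∩ E) ≤
            Real.exp (-∑ w ∈ S, ∑ x ∈ {v}, q s(w, x)) * P.real E := by
          rw [← measureReal_biUnion_finset hdisj fun T _ => (hNm T).inter hEm]
          refine (measureReal_mono ?_).trans
            (measureReal_cutSurvives_le μ hq (Finset.disjoint_singleton_right.2 hv) haJ)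
          rintro ω hω w hw x hx
          simp only [Set.mem_iUnion] at hω
          obtain ⟨T, hT, hωT, hωE⟩ := hω
          by_cases hxv : x = v
          · subst hxv
            have hx' : x ∉ nextReached H S a ω := by
              rw [hωT]
              exact (Finset.mem_filter.1 hT).2.2
            rw [mem_nextReached, not_or] at hx'
            by_contra hcon
            exact hx'.2 ⟨w, hw, by simpa using hcon⟩
          · simpa [hxv] using hωE w hw x hx
        have hmono : ∑ T ∈ 𝓣, P.real (N T ∩ E) * Ψ T.card ≤
            ∑ T ∈ 𝓣, P.real (N T ∩ E) * Ψ S.card := by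
          refine Finset.sum_le_sum fun T hT => mul_le_mul_of_nonneg_left (hΨ ?_) measureReal_nonneg
          exact Finset.card_le_card (Finset.mem_filter.1 hT).2.1
        rw [← Finset.sum_mul] at hmono
        refine hmono.trans ?_
        simp only [Finset.sum_singleton] at hmiss
        have h1 : ∑ T ∈ 𝓣, P.real (N T ∩ E) ≤ γ * P.real E :=
          hmiss.trans (mul_le_mul_of_nonneg_right hB measureReal_nonneg)
        have h2 := mul_le_mul_of_nonneg_right h1 (zero_le_one.trans (hΨS S))
        linarith
    calc P.real (E ∩ missed H v (j + 1) S a)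
        ≤ ∑ T ∈ 𝓣, P.real ((N T ∩ E) ∩ missed H v j T (nextAge S a)) :=
          (measureReal_mono hcover (measure_ne_top _ _)).trans (measureReal_biUnion_finset_le _ _)
      _ ≤ ∑ T ∈ 𝓣, P.real (N T ∩ E) * Ψ T.card * γ ^ j := Finset.sum_le_sum hterm
      _ ≤ P.real E * (γ * Ψ S.card) * γ ^ j := by
          rw [← Finset.sum_mul]
          exact mul_le_mul_of_nonneg_right hmain (pow_nonneg hγ _)
      _ = P.real E * Ψ S.card * γ ^ (j + 1) := by ring

end Exploration

/-! ### One pair: uniform quantiles, hazard and Laplace transform. -/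

section PairLaw

/-- The values of a pair that do not yield an edge whose cost has quantile below `κ j`. -/
def slowSet (D : Measure ℝ) (κ : ℝ) (j : ℕ) : Set (Bool × ℝ) :=
  {y | y.1 = true → κ * j ≤ cdf D y.2}

theorem slowSet_zero (D : Measure ℝ) (κ : ℝ) : slowSet D κ 0 = Set.univ :=
  Set.eq_univ_of_forall fun y _ => by simpa using cdf_nonneg D y.2

theorem slowSet_antitone (D : Measure ℝ) {κ : ℝ} (hκ : 0 ≤ κ) : Antitone (slowSet D κ) := by
  intro i j hij y hy h
  have : (i : ℝ) ≤ j := by exact_mod_cast hij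
  exact (mul_le_mul_of_nonneg_left this hκ).trans (hy h)

theorem measurableSet_cdf_lt (D : Measure ℝ) (s : ℝ) : MeasurableSet {x | cdf D x < s} :=
  measurableSet_lt (monotone_cdf D).measurable measurable_const

theorem compl_slowSet (D : Measure ℝ) (κ : ℝ) (j : ℕ) :
    (slowSet D κ j)ᶜ = {true} ×ˢ {x | cdf D x < κ * j} := by
  ext ⟨b, x⟩
  simp [slowSet]

theorem measurableSet_slowSet (D : Measure ℝ) (κ : ℝ) (j : ℕ) :
    MeasurableSet (slowSet D κ j) := by
  rw [← MeasurableSet.compl_iff, compl_slowSet]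
  exact (measurableSet_singleton _).prod (measurableSet_cdf_lt D _)

/-- If the cdf of `D` is continuous then it is uniformly distributed under `D`. -/
theorem measure_cdf_lt {D : Measure ℝ} [IsProbabilityMeasure D] (hD : Continuous (cdf D)) {s : ℝ}
    (hs0 : 0 ≤ s) (hs1 : s ≤ 1) : D {x | cdf D x < s} = ENNReal.ofReal s := by
  have hle : ∀ r, 0 < r → r < 1 → D {x | cdf D x < r} = ENNReal.ofReal r := by
    intro r hr0 hr1
    set A := {x | r ≤ cdf D x} with hA
    have hne : A.Nonempty :=
      (((tendsto_cdf_atTop D).eventually (lt_mem_nhds hr1)).exists).imp fun _ h => le_of_lt h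
    obtain ⟨y, hy⟩ := ((tendsto_cdf_atBot D).eventually (gt_mem_nhds hr0)).exists
    have hbdd : BddBelow A := ⟨y, fun x hx => by
      by_contra! h
      exact absurd (hx.trans (monotone_cdf D h.le)) (not_le.2 hy)⟩
    have hclosed : IsClosed A := isClosed_le continuous_const hD
    have hmem : r ≤ cdf D (sInf A) := hclosed.csInf_mem hne hbdd
    -- The sublevel set is an open half-line, and continuity makes the cdf equal to `r` at its
    -- endpoint.
    have hIio : {x | cdf D x < r} = Set.Iio (sInf A) := by
      ext x
      constructor
      · intro hx
        by_contra h
        exact absurd (hmem.trans (monotone_cdf D (not_lt.1 h))) (not_le.2 hx)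
      · intro hx
        exact show cdf D x < r from not_le.1 fun h => absurd (csInf_le hbdd h) (not_le.2 hx)
    have hval : cdf D (sInf A) = r := by
      refine le_antisymm ?_ hmem
      refine le_of_tendsto (hD.continuousWithinAt (s := Set.Iio (sInf A)) (x := sInf A)) ?_
      filter_upwards [self_mem_nhdsWithin] with x hx
      have : x ∈ {x | cdf D x < r} := by rw [hIio]; exact hx
      exact le_of_lt this
    rw [hIio]
    have hmeas := (cdf D).measure_Iio (tendsto_cdf_atBot D) (sInf A)
    rw [measure_cdf, sub_zero, leftLim_eq_of_tendsto
      hD.continuousWithinAt, hval] at hmeas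
    exact hmeas
  rcases hs0.eq_or_lt with rfl | hs0
  · have : {x | cdf D x < 0} = ∅ :=
      Set.eq_empty_of_forall_notMem fun x hx => absurd (cdf_nonneg D x) (not_le.2 hx)
    simp [this]
  rcases hs1.eq_or_lt with rfl | hs1
  -- The level 1 need not be attained. A deficit there would contradict the case of a level `r < 1`
  -- above the supposed mass.
  · rw [ENNReal.ofReal_one]
    refine le_antisymm prob_le_one (not_lt.1 fun hlt => ?_)
    have hx : D.real {x | cdf D x < 1} < 1 := by
      rw [measureReal_def]
      exact ENNReal.toReal_lt_of_lt_ofReal (by simpa using hlt)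
    have hx0 : 0 ≤ D.real {x | cdf D x < 1} := measureReal_nonneg
    set r := (1 + D.real {x | cdf D x < 1}) / 2 with hr
    have hmono : D.real {x | cdf D x < r} ≤ D.real {x | cdf D x < 1} :=
      measureReal_mono fun x (hx' : cdf D x < r) => hx'.trans (by linarith)
    rw [measureReal_def, hle r (by linarith) (by linarith),
      ENNReal.toReal_ofReal (by linarith)] at hmono
    linarith
  · exact hle s hs0 hs1

theorem isProbabilityMeasure_pairLaw {p : ℝ} (hp0 : 0 ≤ p) (hp1 : p ≤ 1) (D : Measure ℝ)
    [IsProbabilityMeasure D] : IsProbabilityMeasure (pairLaw p D) := by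
  have : IsProbabilityMeasure
      (ENNReal.ofReal p • Measure.dirac true + ENNReal.ofReal (1 - p) • Measure.dirac false) :=
    ⟨by simp [← ENNReal.ofReal_add hp0 (sub_nonneg.2 hp1)]⟩
  unfold pairLaw
  infer_instance

theorem pairLaw_true_prod (p : ℝ) (D : Measure ℝ) [IsProbabilityMeasure D] (A : Set ℝ) :
    pairLaw p D ({true} ×ˢ A) = ENNReal.ofReal p * D A := by
  simp [pairLaw, Measure.prod_prod]

theorem pairLaw_real_slowSet {p : ℝ} (hp0 : 0 ≤ p) (hp1 : p ≤ 1) {D : Measure ℝ}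
    [IsProbabilityMeasure D] (hD : Continuous (cdf D)) {κ : ℝ} (hκ : 0 ≤ κ) {j : ℕ}
    (hj : κ * j ≤ 1) : (pairLaw p D).real (slowSet D κ j) = 1 - p * (κ * j) := by
  have := isProbabilityMeasure_pairLaw hp0 hp1 D
  have h0 : 0 ≤ κ * j := by positivity
  rw [← compl_compl (slowSet D κ j), probReal_compl_eq_one_sub (measurableSet_slowSet D κ j).compl,
    compl_slowSet, measureReal_def, pairLaw_true_prod, measure_cdf_lt hD h0 hj,
    ← ENNReal.ofReal_mul hp0, ENNReal.toReal_ofReal (by positivity)]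

/-- A uniform variable has increasing hazard. -/
theorem pairLaw_real_slowSet_succ_le {p : ℝ} (hp0 : 0 ≤ p) (hp1 : p ≤ 1) {D : Measure ℝ}
    [IsProbabilityMeasure D] (hD : Continuous (cdf D)) {κ : ℝ} (hκ : 0 ≤ κ) {j : ℕ}
    (hj : κ * (j + 1 : ℕ) ≤ 1) :
    (pairLaw p D).real (slowSet D κ (j + 1)) ≤
      Real.exp (-(p * κ)) * (pairLaw p D).real (slowSet D κ j) := by
  have hj' : κ * j ≤ 1 := le_trans (by gcongr; simp) hj
  rw [pairLaw_real_slowSet hp0 hp1 hD hκ hj, pairLaw_real_slowSet hp0 hp1 hD hκ hj']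
  have h0 : 0 ≤ κ * j := by positivity
  have h1 : 0 ≤ 1 - p * (κ * j) := by nlinarith
  have h2 := mul_le_mul_of_nonneg_right (Real.one_sub_le_exp_neg (p * κ)) h1
  refine le_trans ?_ h2
  push_cast
  have : 0 ≤ p * κ * (p * (κ * j)) := by positivity
  linarith

/-- The expected Gibbs weight of a pair whose cost distribution has cdf at most `A s + B s²`. -/
theorem lintegral_edgeWeight_le {p : ℝ} (hp0 : 0 ≤ p) {D : Measure ℝ}
    [IsProbabilityMeasure D] {A B θ : ℝ} (hA : 0 ≤ A) (hB : 0 ≤ B) (hθ : 0 < θ)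
    (hD : ∀ s, 0 ≤ s → cdf D s ≤ A * s + B * s ^ 2) :
    ∫⁻ y, edgeWeight θ y ∂pairLaw p D ≤ ENNReal.ofReal (p * (A / θ + 2 * B / θ ^ 2)) := by
  have h1 : ∫⁻ y, edgeWeight θ y ∂pairLaw p D =
      ENNReal.ofReal p * ∫⁻ c, ENNReal.ofReal (Real.exp (-θ * max c 0)) ∂D := by
    rw [pairLaw, lintegral_prod _ (measurable_edgeWeight θ).aemeasurable, lintegral_add_measure,
      lintegral_smul_measure, lintegral_smul_measure, lintegral_dirac, lintegral_dirac]
    simp [edgeWeight]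
  -- Writing the exponential as the integral of its density beyond `c` lets Tonelli turn the Laplace
  -- transform into an integral of the cdf.
  have hexp : ∀ c : ℝ, ENNReal.ofReal (Real.exp (-θ * max c 0)) ≤
      ∫⁻ s in Set.Ioi (0 : ℝ),
        (Set.Iic s).indicator 1 c * ENNReal.ofReal (θ * Real.exp (-θ * s)) := by
    intro c
    have hint := integral_exp_mul_Ioi (a := -θ) (by linarith) (max c 0)
    have hio := integrableOn_exp_mul_Ioi (a := -θ) (by linarith) (max c 0)
    have h2 : ENNReal.ofReal (Real.exp (-θ * max c 0)) =
        ∫⁻ s in Set.Ioi (max c 0), ENNReal.ofReal (θ * Real.exp (-θ * s)) := by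
      rw [← ofReal_integral_eq_lintegral_ofReal (hio.const_mul θ)
        (ae_of_all _ fun s => by positivity), integral_const_mul, hint]
      congr 1
      field_simp
    rw [h2]
    refine (setLIntegral_mono' measurableSet_Ioi fun s hs => ?_).trans
      (lintegral_mono_set (Set.Ioi_subset_Ioi (le_max_right c 0)))
    have hcs : c ≤ s := (le_max_left c 0).trans (le_of_lt hs)
    simp [hcs]
  have hswap : ∫⁻ c, ENNReal.ofReal (Real.exp (-θ * max c 0)) ∂D ≤
      ∫⁻ s in Set.Ioi (0 : ℝ), D (Set.Iic s) * ENNReal.ofReal (θ * Real.exp (-θ * s)) := by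
    refine (lintegral_mono hexp).trans (le_of_eq ?_)
    rw [lintegral_lintegral_swap]
    · refine lintegral_congr fun s => ?_
      rw [lintegral_mul_const _ (measurable_one.indicator measurableSet_Iic),
        lintegral_indicator_one measurableSet_Iic]
    · refine (Measurable.mul ?_ (by fun_prop)).aemeasurable
      exact measurable_one.indicator (measurableSet_le measurable_fst measurable_snd)
  have hgamma : ∀ m : ℕ, IntegrableOn (fun s : ℝ => s ^ m * Real.exp (-θ * s)) (Set.Ioi 0) ∧
      ∫ s in Set.Ioi (0 : ℝ), s ^ m * Real.exp (-θ * s) = (m.factorial : ℝ) / θ ^ (m + 1) := by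
    intro m
    have h := Real.integral_rpow_mul_exp_neg_mul_Ioi (a := (m : ℝ) + 1) (by positivity) hθ
    rw [Real.Gamma_nat_eq_factorial, add_sub_cancel_right, ← Nat.cast_add_one] at h
    simp only [Real.rpow_natCast, ← neg_mul] at h
    have h' : ∫ s in Set.Ioi (0 : ℝ), s ^ m * Real.exp (-θ * s) =
        (m.factorial : ℝ) / θ ^ (m + 1) := by
      rw [h, one_div, inv_pow, div_eq_inv_mul]
    refine ⟨?_, h'⟩
    -- The integral of a non-integrable function is 0 by convention, but the value found is
    -- positive.
    by_contra hcon
    rw [integral_undef hcon] at h'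
    have : 0 < (m.factorial : ℝ) / θ ^ (m + 1) := by positivity
    linarith
  rw [h1, ENNReal.ofReal_mul hp0]
  refine mul_le_mul_right (hswap.trans ?_) _
  have hint : IntegrableOn (fun s : ℝ => (A * s + B * s ^ 2) * (θ * Real.exp (-θ * s)))
      (Set.Ioi 0) := by
    have := (((hgamma 1).1.const_mul (A * θ)).add ((hgamma 2).1.const_mul (B * θ)))
    refine this.congr (ae_of_all _ fun s => ?_)
    simp only [Pi.add_apply]
    ring
  have hval : ∫ s in Set.Ioi (0 : ℝ), (A * s + B * s ^ 2) * (θ * Real.exp (-θ * s)) =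
      A / θ + 2 * B / θ ^ 2 := by
    have : ∀ s : ℝ, (A * s + B * s ^ 2) * (θ * Real.exp (-θ * s)) =
        A * θ * (s ^ 1 * Real.exp (-θ * s)) + B * θ * (s ^ 2 * Real.exp (-θ * s)) := fun s => by
      ring
    simp only [this]
    rw [integral_add ((hgamma 1).1.const_mul _) ((hgamma 2).1.const_mul _), integral_const_mul,
      integral_const_mul, (hgamma 1).2, (hgamma 2).2]
    simp [Nat.factorial]
    field_simp
  rw [← hval, ofReal_integral_eq_lintegral_ofReal hint]
  · refine setLIntegral_mono' measurableSet_Ioi fun s hs => ?_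
    have hs0 : 0 ≤ s := le_of_lt hs
    rw [ENNReal.ofReal_mul (p := A * s + B * s ^ 2) (by positivity), ← ofReal_cdf]
    exact mul_le_mul_left (ENNReal.ofReal_le_ofReal (hD s hs0)) _
  · filter_upwards [ae_restrict_mem measurableSet_Ioi] with s hs
    have hs0 : 0 ≤ s := le_of_lt hs
    simp only [Pi.zero_apply]
    positivity

end PairLaw

/-! ### Linearization of the cdfs at 0. -/

section CdfNearZero

/-- Linear bounds for a cdf near `0` from its right derivative at `0`. -/
theorem eventually_cdf_between {D : Measure ℝ} {l δ : ℝ} (hl : 0 < l) (hδ : 0 < δ)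
    (h0 : cdf D 0 = 0) (hD : HasDerivWithinAt (cdf D) l (Set.Ici 0) 0) :
    ∀ᶠ x in 𝓝[≥] (0 : ℝ), l * (1 - δ) * x ≤ cdf D x ∧ cdf D x ≤ l * (1 + δ) * x := by
  have h := (hasDerivWithinAt_iff_isLittleO.1 hD).bound (mul_pos hl hδ)
  filter_upwards [h, self_mem_nhdsWithin] with x hx hx0
  have hx0' : 0 ≤ x := hx0
  rw [h0, sub_zero, sub_zero, Real.norm_eq_abs, Real.norm_eq_abs, abs_of_nonneg hx0',
    smul_eq_mul, abs_le] at hx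
  constructor <;> nlinarith [hx.1, hx.2]

/-- Uniform linear bounds near `0` for finitely many cdfs. -/
theorem exists_cdf_bounds {ι : Type*} [Finite ι] {D : ι → Measure ℝ} {l : ι → ℝ}
    (hl : ∀ i, 0 < l i) {δ : ℝ} (hδ : 0 < δ) (h0 : ∀ i, cdf (D i) 0 = 0)
    (hD : ∀ i, HasDerivWithinAt (cdf (D i)) (l i) (Set.Ici 0) 0) :
    ∃ r > 0, ∀ i, (∀ x, 0 ≤ x → x ≤ r → l i * (1 - δ) * x ≤ cdf (D i) x) ∧
      ∀ x, 0 ≤ x → cdf (D i) x ≤ l i * (1 + δ) * x + (r⁻¹) ^ 2 * x ^ 2 := by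
  have h : ∀ᶠ x in 𝓝[≥] (0 : ℝ), ∀ i, l i * (1 - δ) * x ≤ cdf (D i) x ∧
      cdf (D i) x ≤ l i * (1 + δ) * x :=
    eventually_all.2 fun i => eventually_cdf_between (hl i) hδ (h0 i) (hD i)
  obtain ⟨r, hr, hr'⟩ := (mem_nhdsGE_iff_exists_Icc_subset).1 h
  refine ⟨r, hr, fun i => ⟨fun x hx0 hxr => (hr' ⟨hx0, hxr⟩ i).1, fun x hx0 => ?_⟩⟩
  have hr0 : (0 : ℝ) < r := hr
  rcases le_total x r with hxr | hxr
  · exact (hr' ⟨hx0, hxr⟩ i).2.trans (le_add_of_nonneg_right (by positivity))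
  -- Beyond `r` the quadratic term alone is at least 1. It makes the bound global, as the Laplace
  -- transform requires.
  · refine (cdf_le_one _ x).trans ?_
    have h1 : 1 ≤ r⁻¹ * x := by rw [inv_mul_eq_div, one_le_div hr0]; exact hxr
    have h2 : 0 ≤ l i * (1 + δ) * x := by have := hl i; positivity
    nlinarith

end CdfNearZero

/-! ### From explored vertices to path costs. -/

section GraphExploration

variable {n : ℕ}

theorem shortestPathCost_self (g : GraphData n) (u : Fin n) : g.shortestPathCost u u = 0 :=
  le_antisymm (iInf_le_of_le SimpleGraph.Walk.nil (by simp [GraphData.pathCost])) zero_le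

theorem shortestPathCost_le_add (g : GraphData n) (u : Fin n) {w x : Fin n} (hwx : w ≠ x)
    (he : (g s(w, x)).1 = true) :
    g.shortestPathCost u x ≤ g.shortestPathCost u w + ENNReal.ofReal (g.cost s(w, x)) := by
  have hadj : g.graph.Adj w x := by
    simp only [GraphData.graph, SimpleGraph.fromEdgeSet_adj]
    exact ⟨he, hwx⟩
  unfold GraphData.shortestPathCost
  rw [ENNReal.iInf_add]
  refine le_iInf fun p => iInf_le_of_le (p.concat hadj) ?_
  simp [GraphData.pathCost, SimpleGraph.Walk.edges_concat]

/-- A vertex reached by the exploration is within the explored distance. -/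
theorem shortestPathCost_le_of_notMem_missed {H : Sym2 (Fin n) → ℕ → Set (Bool × ℝ)} {h : ℝ}
    {J : ℕ} (hh : 0 ≤ h)
    (hH : ∀ e j y, j ≤ J → y ∉ H e j → y.1 = true ∧ y.2 ≤ j * h)
    (g : GraphData n) (u v : Fin n) (j i : ℕ) (hij : i + j = J) (S : Finset (Fin n))
    (a : Fin n → ℕ) (ha : ∀ w ∈ S, a w ≤ i)
    (hS : ∀ w ∈ S, g.shortestPathCost u w ≤ ENNReal.ofReal ((i - a w : ℕ) * h))
    (hg : g ∉ missed H v j S a) : g.shortestPathCost u v ≤ ENNReal.ofReal (J * h) := by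
  have hdone : ∀ w ∈ S, g.shortestPathCost u w ≤ ENNReal.ofReal (J * h) := fun w hw => by
    refine (hS w hw).trans (ENNReal.ofReal_le_ofReal ?_)
    gcongr
    omega
  induction j generalizing i S a with
  | zero =>
    simp only [missed, Set.mem_ofPred_eq, not_not] at hg
    exact hdone v hg
  | succ j ih =>
    simp only [missed, Set.mem_ofPred_eq, not_and] at hg
    by_cases hv : v ∈ S
    · exact hdone v hv
    have hage : ∀ w ∈ nextReached H S a g, nextAge S a w ≤ i + 1 := fun w _ => by
      simp only [nextAge]
      split_ifs with hwS
      · exact Nat.succ_le_succ (ha w hwS)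
      · omega
    have hdist : ∀ w ∈ nextReached H S a g, g.shortestPathCost u w ≤
        ENNReal.ofReal ((i + 1 - nextAge S a w : ℕ) * h) := fun x hx => by
      by_cases hxS : x ∈ S
      · simpa [nextAge, hxS] using hS x hxS
      -- `w` was reached at step `i - a w`, and the pair takes at most `a w + 1` steps, which adds
      -- up to `i + 1`.
      · obtain ⟨w, hw, hwx⟩ := (mem_nextReached.1 hx).resolve_left hxS
        have haw := ha w hw
        obtain ⟨h1, h2⟩ := hH _ _ _ (by omega) hwx
        have hne : w ≠ x := fun h => hxS (h ▸ hw)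
        refine (shortestPathCost_le_add g u hne h1).trans ?_
        refine (add_le_add (hS w hw) (ENNReal.ofReal_le_ofReal h2)).trans ?_
        rw [← ENNReal.ofReal_add (by positivity) (by positivity)]
        refine ENNReal.ofReal_le_ofReal (le_of_eq ?_)
        simp only [nextAge, hxS, if_false, tsub_zero]
        push_cast [Nat.cast_sub haw]
        ring
    refine ih (i + 1) (by omega) _ _ hage hdist (hg hv) fun w hw => ?_
    refine (hdist w hw).trans (ENNReal.ofReal_le_ofReal ?_)
    gcongr
    omega

/-- Since `l * (j * h) ≤ cdf D (j * h)`, a cost with quantile below `l * h * j` is at most `j * h`.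
Time measured in quantiles thus bounds true cost. -/
theorem notMem_slowSet {D : Measure ℝ} {l h t : ℝ} {J j : ℕ} (hh : 0 ≤ h)
    (ht : J * h ≤ t) (hD : ∀ x, 0 ≤ x → x ≤ t → l * x ≤ cdf D x) (hj : j ≤ J)
    {y : Bool × ℝ} (hy : y ∉ slowSet D (l * h) j) : y.1 = true ∧ y.2 ≤ j * h := by
  simp only [slowSet, Set.mem_ofPred_eq, Classical.not_imp, not_le] at hy
  refine ⟨hy.1, not_lt.1 fun hlt => ?_⟩
  have hjJ : (j : ℝ) * h ≤ J * h := by gcongr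
  have h1 := hD (j * h) (by positivity) (hjJ.trans ht)
  have h2 := monotone_cdf D hlt.le
  linarith [hy.2]

end GraphExploration

/-! ### The potential and the tail of the exploration time. -/

section Tail

/-- A potential that decreases from `k` to `k + 1` by at least the fraction `β / k`, and is at
least `1` up to `n`. -/
noncomputable def potential (n β : ℝ) (k : ℕ) : ℝ :=
  if k ≤ 1 then 2 * n ^ β else (n / ((k : ℝ) - 1)) ^ β

theorem potential_nonneg {n : ℝ} (hn : 0 ≤ n) (β : ℝ) (k : ℕ) : 0 ≤ potential n β k := by
  unfold potential
  split_ifs with hk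
  · positivity
  · have : (2 : ℝ) ≤ k := by exact_mod_cast not_le.1 hk
    exact Real.rpow_nonneg (div_nonneg hn (by linarith)) _

/-- From `2` on this is Bernoulli's inequality `(1 - 1/k)^β ≤ 1 - β/k`. At `k = 1`, where the
formula would divide by 0, the factor 2 gives a drop by half, which suffices as `β ≤ 1/2`. -/
theorem potential_succ_le {n β : ℝ} (hn : 0 ≤ n) (hβ : 0 ≤ β) (hβ2 : β ≤ 1 / 2) {k : ℕ}
    (hk : 1 ≤ k) : potential n β (k + 1) ≤ (1 - β / k) * potential n β k := by
  rcases hk.eq_or_lt with rfl | hk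
  · have : 0 ≤ n ^ β := Real.rpow_nonneg hn _
    simp only [potential, Nat.reduceAdd, Nat.not_ofNat_le_one, if_false, le_refl, if_true,
      Nat.cast_ofNat, Nat.cast_one, div_one]
    norm_num
    nlinarith
  · have hk2 : (2 : ℝ) ≤ k := by exact_mod_cast hk
    have h1 : ¬ k + 1 ≤ 1 := by omega
    have h2 : ¬ k ≤ 1 := by omega
    simp only [potential, h1, h2, if_false]
    push_cast
    have hsplit : n / ((k : ℝ) + 1 - 1) = (1 + -(1 / k)) * (n / ((k : ℝ) - 1)) := by
      have h3 : (k : ℝ) - 1 ≠ 0 := by linarith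
      have h4 : (k : ℝ) ≠ 0 := by linarith
      rw [add_sub_cancel_right]
      field_simp
      ring
    have h3 : 0 ≤ 1 + -(1 / (k : ℝ)) := by
      have : 1 / (k : ℝ) ≤ 1 / 2 := one_div_le_one_div_of_le (by norm_num) hk2
      linarith
    have h4 : 0 ≤ n / ((k : ℝ) - 1) := div_nonneg hn (by linarith)
    rw [hsplit, Real.mul_rpow h3 h4]
    refine mul_le_mul_of_nonneg_right ?_ (Real.rpow_nonneg h4 _)
    refine (rpow_one_add_le_one_add_mul_self (by linarith) hβ (by linarith)).trans (le_of_eq ?_)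
    ring

theorem antitone_potential {n β : ℝ} (hn : 0 ≤ n) (hβ : 0 ≤ β) (hβ2 : β ≤ 1 / 2) :
    Antitone (potential n β) := by
  refine antitone_nat_of_succ_le fun k => ?_
  rcases Nat.eq_zero_or_pos k with rfl | hk
  · simp [potential]
  · refine (potential_succ_le hn hβ hβ2 hk).trans ?_
    have := potential_nonneg hn β k
    have hq : 0 ≤ β / k := by positivity
    nlinarith

theorem one_le_potential {n β : ℝ} (hn : 1 ≤ n) (hβ : 0 ≤ β) {k : ℕ} (hk : (k : ℝ) ≤ n) :
    1 ≤ potential n β k := by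
  unfold potential
  split_ifs with h
  · have := Real.one_le_rpow hn hβ
    linarith
  · have h2 : (2 : ℝ) ≤ k := by exact_mod_cast not_le.1 h
    refine Real.one_le_rpow ?_ hβ
    rw [one_le_div (by linarith)]
    linarith

theorem exp_neg_le_inv_one_add {s : ℝ} (hs : 0 ≤ s) : Real.exp (-s) ≤ (1 + s)⁻¹ := by
  rw [Real.exp_neg]
  exact inv_anti₀ (by linarith) (by linarith [Real.add_one_le_exp s])

/-- Tail bound for the exploration: a vertex `v` is missed for `J` steps with probability
exponentially small in `J`, when each of the first `K` reached vertices has total hazard at least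
`η` of reaching a new vertex in each step. -/
theorem measureReal_missed_le_rpow_mul_exp {V : Type*} [Fintype V] [DecidableEq V] {Ω : Type*}
    [MeasurableSpace Ω] {H : Sym2 V → ℕ → Set Ω}
    (hH : ∀ e j, MeasurableSet (H e j)) (hH0 : ∀ e, H e 0 = Set.univ)
    (hanti : ∀ e, Antitone (H e)) (μ : Sym2 V → Measure Ω) [∀ e, IsProbabilityMeasure (μ e)]
    {q : Sym2 V → ℝ} {J : ℕ}
    (hq : ∀ e j, j < J → (μ e).real (H e (j + 1)) ≤ Real.exp (-q e) * (μ e).real (H e j))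
    {β η δ K q₀ : ℝ} (hβ : 0 < β) (hβ2 : β ≤ 1 / 2) (hη : 0 ≤ η) (hδ : δ ≤ 1)
    (hηδ : Fintype.card V * η ≤ δ)
    (hrow : ∀ S : Finset V, (S.card : ℝ) ≤ K → ∀ w, η ≤ ∑ x ∈ Sᶜ, q s(w, x))
    (hq₀ : 0 ≤ q₀) (hmin : ∀ e, q₀ ≤ q e) (hK : 2 * β * η ≤ K * q₀) (u v : V) :
    (Measure.pi μ).real (missed H v J {u} 0) ≤
      2 * (Fintype.card V : ℝ) ^ β * Real.exp (-(β * η / (1 + δ) * J)) := by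
  set n : ℝ := (Fintype.card V : ℝ) with hn_def
  have hcard : 1 ≤ Fintype.card V := Fintype.card_pos_iff.2 ⟨u⟩
  have hn : 1 ≤ n := Nat.one_le_cast.2 hcard
  have hη1 : η ≤ δ := le_trans (by nlinarith) hηδ
  have hδ0 : 0 ≤ δ := hη.trans hη1
  set θ := β * η / (1 + δ) with hθ
  have hθ0 : 0 ≤ θ := by positivity
  have hθle : θ ≤ β * η := div_le_self (by positivity) (by linarith)
  have hβη : β * η ≤ 1 / 2 := by nlinarith
  have hstep : ∀ S : Finset V, S.Nonempty → v ∉ S →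
      Real.exp (-∑ w ∈ S, ∑ x ∈ Sᶜ, q s(w, x)) *
        (potential n β S.card - potential n β (S.card + 1)) + potential n β (S.card + 1) ≤
        (1 - θ) * potential n β S.card ∨ Real.exp (-∑ w ∈ S, q s(w, v)) ≤ 1 - θ := by
    intro S hS hv
    rcases le_total (S.card : ℝ) K with hSK | hSK
    · left
      set k : ℕ := S.card with hk_def
      have hk : 1 ≤ k := hS.card_pos
      have hk' : (1 : ℝ) ≤ k := by exact_mod_cast hk
      have hkn : (k : ℝ) ≤ n := Nat.cast_le.2 S.card_le_univ
      have hkη : k * η ≤ δ := (mul_le_mul_of_nonneg_right hkn hη).trans hηδ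
      have hsum : k * η ≤ ∑ w ∈ S, ∑ x ∈ Sᶜ, q s(w, x) := by
        rw [hk_def, ← nsmul_eq_mul]
        exact Finset.card_nsmul_le_sum S _ _ fun w _ => hrow S hSK w
      have hκ : Real.exp (-∑ w ∈ S, ∑ x ∈ Sᶜ, q s(w, x)) ≤ (1 + k * η)⁻¹ :=
        (Real.exp_le_exp.2 (neg_le_neg hsum)).trans (exp_neg_le_inv_one_add (by positivity))
      -- The steps are so short that `kη ≤ nη ≤ δ`, so discretization costs only the factor `1 + δ`.
      have hκ' : k * η / (1 + δ) ≤ 1 - (1 + k * η)⁻¹ := by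
        have : 1 - (1 + k * η)⁻¹ = k * η / (1 + k * η) := by
          have : 1 + k * η ≠ 0 := by positivity
          field_simp
          ring
        rw [this]
        gcongr
      have hΨ0 := potential_nonneg (n := n) (by linarith) β k
      have hdrop := potential_succ_le (n := n) (by linarith) hβ.le hβ2 hk
      have hd : β / k * potential n β k ≤ potential n β k - potential n β (k + 1) := by linarith
      have hprod : θ * potential n β k ≤
          (1 - Real.exp (-∑ w ∈ S, ∑ x ∈ Sᶜ, q s(w, x))) *
            (potential n β k - potential n β (k + 1)) := by
        -- The size `k` cancels between the hazard `kη` and the relative drop `β/k`.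
        calc θ * potential n β k = k * η / (1 + δ) * (β / k * potential n β k) := by
              rw [hθ]; field_simp
          _ ≤ _ := mul_le_mul (by linarith) hd (by positivity)
              (le_trans (by positivity) (hκ'.trans (by linarith)))
      linarith
    · right
      have hsum : 2 * β * η ≤ ∑ w ∈ S, q s(w, v) := by
        refine hK.trans ((mul_le_mul_of_nonneg_right hSK hq₀).trans ?_)
        rw [← nsmul_eq_mul]
        exact Finset.card_nsmul_le_sum S _ _ fun w _ => hmin _
      refine (Real.exp_le_exp.2 (neg_le_neg hsum)).trans
        ((exp_neg_le_inv_one_add (by positivity)).trans ?_)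
      -- With `x = βη ≤ 1/2` one has `(1 - x)(1 + 2x) ≥ 1`; this is why the hazard `2βη` is asked
      -- for.
      rw [inv_le_iff_one_le_mul₀ (by positivity)]
      nlinarith
  have hmain := measureReal_missed_le hH hH0 hanti μ hq
    (antitone_potential (n := n) (by linarith) hβ.le hβ2)
    (fun k hk => one_le_potential hn hβ.le (Nat.cast_le.2 hk)) (γ := 1 - θ) (by linarith)
    hstep J {u} (Finset.singleton_nonempty u) 0 (by simp)
  have huniv : cutSurvives H {u} 0 0 = Set.univ :=
    Set.eq_univ_of_forall fun ω w _ x _ => by simp [hH0]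
  rw [huniv, Set.univ_inter, probReal_univ, one_mul, Finset.card_singleton] at hmain
  refine hmain.trans ?_
  have h1 : potential n β 1 = 2 * n ^ β := by simp [potential]
  rw [h1]
  refine mul_le_mul_of_nonneg_left ?_ (by positivity)
  have := pow_le_pow_left₀ (by linarith : 0 ≤ 1 - θ) (Real.one_sub_le_exp_neg θ) J
  rw [← Real.exp_nat_mul] at this
  refine this.trans (le_of_eq ?_)
  ring_nf

end Tail

/-! ### Concentration of the block sizes. -/

section BlockSizes

variable {k : ℕ}

/-- The number of vertices in block `b`. -/
def blockSize {n : ℕ} (z : Fin n → Fin k) (b : Fin k) : ℕ :=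
  (Finset.univ.filter fun x => z x = b).card

/-- Every block size is within the factor `1 ± δ` of its mean. -/
def IsBalanced {n : ℕ} (π : Fin k → ℝ) (δ : ℝ) (z : Fin n → Fin k) : Prop :=
  ∀ b, (1 - δ) * (n * π b) ≤ blockSize z b ∧ (blockSize z b : ℝ) ≤ (1 + δ) * (n * π b)

/-- The distribution `π` on the blocks. -/
noncomputable def blockLaw (π : Fin k → ℝ) : Measure (Fin k) :=
  ∑ a, ENNReal.ofReal (π a) • Measure.dirac a

variable {π : Fin k → ℝ}

theorem blockLaw_singleton (π : Fin k → ℝ) (a : Fin k) :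
    blockLaw π {a} = ENNReal.ofReal (π a) := by
  simp only [blockLaw, Measure.finsetSum_apply, Measure.smul_apply, smul_eq_mul]
  rw [Finset.sum_eq_single a]
  · simp
  · intro b _ hb
    simp [hb]
  · simp

theorem isProbabilityMeasure_blockLaw (hπ : ∀ a, 0 ≤ π a) (hsum : ∑ a, π a = 1) :
    IsProbabilityMeasure (blockLaw π) := by
  constructor
  simp only [blockLaw, Measure.finsetSum_apply, Measure.smul_apply, smul_eq_mul, measure_univ,
    mul_one]
  rw [← ENNReal.ofReal_sum_of_nonneg fun a _ => hπ a, hsum, ENNReal.ofReal_one]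

theorem pi_blockLaw_singleton (hπ : ∀ a, 0 ≤ π a) (hsum : ∑ a, π a = 1) {n : ℕ}
    (z : Fin n → Fin k) :
    Measure.pi (fun _ : Fin n => blockLaw π) {z} = ENNReal.ofReal (∏ u, π (z u)) := by
  have := isProbabilityMeasure_blockLaw hπ hsum
  rw [Measure.pi_singleton, ENNReal.ofReal_prod_of_nonneg fun u _ => hπ _]
  simp only [blockLaw_singleton]

/-- Chebyshev's inequality: the block size is a sum of `n` independent indicators, so its variance
is at most `n`. -/
theorem measure_blockSize_le (hπ : ∀ a, 0 < π a) (hsum : ∑ a, π a = 1) {n : ℕ} (hn : 0 < n)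
    {δ : ℝ} (hδ : 0 < δ) (b : Fin k) :
    Measure.pi (fun _ : Fin n => blockLaw π)
      {z | δ * (n * π b) ≤ |(blockSize z b : ℝ) - n * π b|} ≤
      ENNReal.ofReal ((δ * π b) ^ (-2 : ℤ) * (n : ℝ)⁻¹) := by
  have := isProbabilityMeasure_blockLaw (fun a => (hπ a).le) hsum
  let X : Fin k → ℝ := Set.indicator {b} 1
  have hX : MemLp X 2 (blockLaw π) :=
    MemLp.of_bound (Measurable.aestronglyMeasurable (by fun_prop)) 1 (ae_of_all _ fun a => by
      by_cases h : a = b <;> simp [X, h])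
  have hmean : ∫ a, X a ∂blockLaw π = π b := by
    rw [integral_indicator_one (measurableSet_singleton b), measureReal_def, blockLaw_singleton,
      ENNReal.toReal_ofReal (hπ b).le]
  have hvar : variance X (blockLaw π) ≤ 1 := by
    refine (variance_le_sq_of_bounded (a := 0) (b := 1) (ae_of_all _ fun a => ?_)
      (Measurable.aemeasurable (by fun_prop))).trans (by norm_num)
    by_cases h : a = b <;> simp [X, h]
  let P := Measure.pi (fun _ : Fin n => blockLaw π)
  let Y : (Fin n → Fin k) → ℝ := ∑ u : Fin n, fun z => X (z u)
  have hYm : ∀ u : Fin n, MemLp (fun z : Fin n → Fin k => X (z u)) 2 P := fun u =>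
    hX.comp_measurePreserving (measurePreserving_eval (fun _ : Fin n => blockLaw π) u)
  have hY : MemLp Y 2 P := memLp_finsetSum' _ fun u _ => hYm u
  have hYval : ∀ z, Y z = blockSize z b := fun z => by
    simp only [Y, Finset.sum_apply, blockSize, X, Set.indicator_apply, Set.mem_singleton_iff,
      Pi.one_apply, Finset.sum_boole]
  have hYmean : ∫ z, Y z ∂P = n * π b := by
    simp only [Y, Finset.sum_apply]
    rw [integral_finsetSum _ fun u _ => (hYm u).integrable (by norm_num)]
    have : ∀ u : Fin n, ∫ z, X (z u) ∂P = π b := fun u => by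
      rw [← hmean]
      exact integral_comp_eval (μ := fun _ : Fin n => blockLaw π) (i := u) hX.aestronglyMeasurable
    simp [this]
  have hYvar : variance Y P ≤ n := by
    have h := variance_sum_pi (μ := fun _ : Fin n => blockLaw π) (X := fun _ => X) fun _ => hX
    calc variance Y P = ∑ _u : Fin n, variance X (blockLaw π) := h
      _ ≤ ∑ _u : Fin n, (1 : ℝ) := Finset.sum_le_sum fun _ _ => hvar
      _ = n := by simp
  have hn' : (0 : ℝ) < n := by exact_mod_cast hn
  have hc : 0 < δ * (n * π b) := by have := hπ b; positivity
  have hcheb := meas_ge_le_variance_div_sq hY hc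
  rw [hYmean] at hcheb
  simp only [hYval] at hcheb
  refine hcheb.trans (ENNReal.ofReal_le_ofReal ?_)
  have hb := hπ b
  calc variance Y P / (δ * (n * π b)) ^ 2 ≤ n / (δ * (n * π b)) ^ 2 := by gcongr
    _ = (δ * π b) ^ (-2 : ℤ) * (n : ℝ)⁻¹ := by
      rw [zpow_neg]
      norm_cast
      field_simp

/-- Block assignments are balanced with probability tending to `1`. -/
theorem tendsto_measure_not_isBalanced (hπ : ∀ a, 0 < π a) (hsum : ∑ a, π a = 1) {δ : ℝ}
    (hδ : 0 < δ) :
    Tendsto (fun n : ℕ => Measure.pi (fun _ : Fin n => blockLaw π) {z | ¬ IsBalanced π δ z})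
      atTop (𝓝 0) := by
  have hlim : Tendsto (fun n : ℕ => ∑ b, ENNReal.ofReal ((δ * π b) ^ (-2 : ℤ) * (n : ℝ)⁻¹))
      atTop (𝓝 0) := by
    have : (0 : ℝ≥0∞) = ∑ b : Fin k, ENNReal.ofReal ((δ * π b) ^ (-2 : ℤ) * 0) := by simp
    rw [this]
    refine tendsto_finsetSum _ fun b _ => ENNReal.tendsto_ofReal ?_
    exact tendsto_const_nhds.mul tendsto_inv_atTop_nhds_zero_nat
  refine tendsto_of_tendsto_of_tendsto_of_le_of_le' tendsto_const_nhds hlim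
    (Eventually.of_forall fun _ => zero_le) ?_
  filter_upwards [eventually_gt_atTop 0] with n hn
  calc Measure.pi (fun _ : Fin n => blockLaw π) {z | ¬ IsBalanced π δ z}
      ≤ Measure.pi (fun _ : Fin n => blockLaw π)
          (⋃ b, {z | δ * (n * π b) ≤ |(blockSize z b : ℝ) - n * π b|}) := by
        refine measure_mono fun z hz => ?_
        simp only [IsBalanced, Set.mem_ofPred_eq, not_forall] at hz
        obtain ⟨b, hb⟩ := hz
        refine Set.mem_iUnion.2 ⟨b, ?_⟩
        simp only [Set.mem_ofPred_eq]
        by_contra! hlt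
        rw [abs_lt] at hlt
        exact hb ⟨by linarith [hlt.1], by linarith [hlt.2]⟩
    _ ≤ ∑ b, Measure.pi (fun _ : Fin n => blockLaw π)
          {z | δ * (n * π b) ≤ |(blockSize z b : ℝ) - n * π b|} := measure_iUnion_fintype_le _ _
    _ ≤ _ := Finset.sum_le_sum fun b _ => measure_blockSize_le hπ hsum hn hδ b

end BlockSizes

/-! ### The growth rates. -/

section Tau

variable {k : ℕ} (Λ B : Matrix (Fin k) (Fin k) ℝ) (π : Fin k → ℝ)

theorem tau_apply (a : Fin k) : tau Λ B π a = ∑ b, π b * (B a b * Λ a b) := by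
  simp only [tau, operatorT, Matrix.mulVec, dotProduct, Matrix.mul_diagonal,
    Matrix.hadamard_apply, mul_one]
  exact Finset.sum_congr rfl fun b _ => by ring

theorem tauMin_le (a : Fin k) : tauMin Λ B π ≤ tau Λ B π a :=
  ciInf_le (Set.finite_range _).bddBelow a

theorem le_tauMax (a : Fin k) : tau Λ B π a ≤ tauMax Λ B π :=
  le_ciSup (Set.finite_range _).bddAbove a

variable {Λ B π}

theorem tau_pos (hπ : ∀ a, 0 < π a) (hB : ∀ a b, 0 < B a b) (hΛ : ∀ a b, 0 < Λ a b) (a : Fin k) :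
    0 < tau Λ B π a := by
  rw [tau_apply]
  exact Finset.sum_pos (fun b _ => mul_pos (hπ b) (mul_pos (hB a b) (hΛ a b)))
    ⟨a, Finset.mem_univ a⟩

theorem tauMin_pos [Nonempty (Fin k)] (hπ : ∀ a, 0 < π a) (hB : ∀ a b, 0 < B a b)
    (hΛ : ∀ a b, 0 < Λ a b) : 0 < tauMin Λ B π := by
  obtain ⟨i, hi⟩ := exists_eq_ciInf_of_finite (f := tau Λ B π)
  rw [tauMin, ← hi]
  exact tau_pos hπ hB hΛ i

theorem tauMax_pos [Nonempty (Fin k)] (hπ : ∀ a, 0 < π a) (hB : ∀ a b, 0 < B a b)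
    (hΛ : ∀ a b, 0 < Λ a b) : 0 < tauMax Λ B π :=
  (tau_pos hπ hB hΛ (Classical.arbitrary _)).trans_le (le_tauMax Λ B π _)

end Tau

/-! ### Both distance bounds for a fixed balanced block assignment. -/

section FixedBlocks

variable {k n : ℕ}

/-- `graphLaw` reads the blocks of a pair in the order of its vertices; symmetry removes this order.
-/
theorem apply_inf_sup {α : Type*} {f : Fin k → Fin k → α} (hf : ∀ a b, f a b = f b a)
    (z : Fin n → Fin k) (w x : Fin n) : f (z s(w, x).inf) (z s(w, x).sup) = f (z w) (z x) := by
  rcases le_total w x with h | h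
  · simp [Sym2.inf_mk, Sym2.sup_mk, h]
  · simp [Sym2.inf_mk, Sym2.sup_mk, h, hf (z x)]

theorem sum_comp_eq_sum_blockSize (z : Fin n → Fin k) (f : Fin k → ℝ) :
    ∑ x, f (z x) = ∑ b, blockSize z b * f b := by
  rw [← Finset.sum_fiberwise Finset.univ z]
  refine Finset.sum_congr rfl fun b _ => ?_
  rw [Finset.sum_congr rfl fun x hx => by rw [(Finset.mem_filter.1 hx).2], Finset.sum_const,
    nsmul_eq_mul]
  rfl

variable {π : Fin k → ℝ} {δ : ℝ} {z : Fin n → Fin k}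

/-- Used with `f` a row of `B ⊙ Λ`, for which the sum on the left is an entry of `τ`. -/
theorem IsBalanced.le_sum (hz : IsBalanced π δ z) {f : Fin k → ℝ} (hf : ∀ b, 0 ≤ f b) :
    (1 - δ) * n * ∑ b, π b * f b ≤ ∑ x, f (z x) := by
  rw [sum_comp_eq_sum_blockSize, Finset.mul_sum]
  refine Finset.sum_le_sum fun b _ => ?_
  have := mul_le_mul_of_nonneg_right (hz b).1 (hf b)
  linarith

theorem IsBalanced.sum_le (hz : IsBalanced π δ z) {f : Fin k → ℝ} (hf : ∀ b, 0 ≤ f b) :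
    ∑ x, f (z x) ≤ (1 + δ) * n * ∑ b, π b * f b := by
  rw [sum_comp_eq_sum_blockSize, Finset.mul_sum]
  refine Finset.sum_le_sum fun b _ => ?_
  have := mul_le_mul_of_nonneg_right (hz b).2 (hf b)
  linarith

variable {B Λ : Matrix (Fin k) (Fin k) ℝ} {F : Fin k → Fin k → Measure ℝ} {ρ : ℝ}

theorem isProbabilityMeasure_pairLaw_smul (hρB : ∀ a b, 0 ≤ B a b * ρ ∧ B a b * ρ ≤ 1)
    (hF : ∀ a b, IsProbabilityMeasure (F a b)) (a b : Fin k) :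
    IsProbabilityMeasure (pairLaw ((ρ • B) a b) (F a b)) := by
  have := hF a b
  refine isProbabilityMeasure_pairLaw ?_ ?_ _
  · simpa [mul_comm] using (hρB a b).1
  · simpa [mul_comm] using (hρB a b).2

/-- Given balanced blocks, each vertex is within distance `t` of any other vertex outside an event
of exponentially small probability. -/
theorem exists_event_shortestPathCost_le (hB : ∀ a b, 0 < B a b) (hBs : ∀ a b, B a b = B b a)
    (hΛ : ∀ a b, 0 < Λ a b) (hΛs : ∀ a b, Λ a b = Λ b a)
    (hρ : 0 < ρ) (hρB : ∀ a b, 0 ≤ B a b * ρ ∧ B a b * ρ ≤ 1)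
    (hF : ∀ a b, IsProbabilityMeasure (F a b)) (hFc : ∀ a b, Continuous (cdf (F a b)))
    (hτ : 0 < tauMin Λ B π) (hδ0 : 0 < δ) (hδ : δ ≤ 1 / 10) {t : ℝ} (ht : 0 < t)
    (hcdf : ∀ a b x, 0 ≤ x → x ≤ t → Λ a b * (1 - δ) * x ≤ cdf (F a b) x)
    {L m β : ℝ} (hL : ∀ a b, B a b * Λ a b ≤ L) (hL0 : 0 < L) (hm : ∀ a b, m ≤ B a b * Λ a b)
    (hm0 : 0 < m) (hβ0 : 0 < β) (hβ : β ≤ 1 / 2) (hβm : 2 * β * L ≤ δ * m)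
    (hz : IsBalanced π δ z) (u v : Fin n) :
    ∃ M : Set (GraphData n), MeasurableSet M ∧
      graphLaw (ρ • B) F z M ≤ ENNReal.ofReal (2 * (n : ℝ) ^ β *
        Real.exp (-(β * ((1 - 3 * δ) * ρ * n * tauMin Λ B π * t) / (1 + δ)))) ∧
      ∀ g ∉ M, g.shortestPathCost u v ≤ ENNReal.ofReal t := by
  set τ := tauMin Λ B π with hτ_def
  have h3δ : 0 < 1 - 3 * δ := by linarith
  have h1δ : 0 < 1 - δ := by linarith
  -- `J` is large enough for `nη ≤ δ` below; the `+ 1` keeps it positive.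
  set J : ℕ := ⌈n * ((1 - 3 * δ) * ρ * n * τ * t) / δ⌉₊ + 1 with hJ
  have hJ1 : (1 : ℝ) ≤ J := by rw [hJ]; simp
  have hJ0 : (0 : ℝ) < J := by linarith
  have hJle : n * ((1 - 3 * δ) * ρ * n * τ * t) / δ ≤ J := by
    rw [hJ]
    push_cast
    exact (Nat.le_ceil _).trans (by linarith)
  set h : ℝ := t / J with hh
  have hh0 : 0 < h := div_pos ht hJ0
  have hJh : J * h = t := by rw [hh]; field_simp
  let l : Fin k → Fin k → ℝ := fun a b => Λ a b * (1 - δ)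
  have hl0 : ∀ a b, 0 < l a b := fun a b => mul_pos (hΛ a b) h1δ
  let A : Sym2 (Fin n) → Fin k := fun e => z e.inf
  let C : Sym2 (Fin n) → Fin k := fun e => z e.sup
  let H : Sym2 (Fin n) → ℕ → Set (Bool × ℝ) := fun e => slowSet (F (A e) (C e)) (l (A e) (C e) * h)
  let q : Sym2 (Fin n) → ℝ := fun e => (ρ • B) (A e) (C e) * (l (A e) (C e) * h)
  let μ : Sym2 (Fin n) → Measure (Bool × ℝ) := fun e =>
    pairLaw ((ρ • B) (A e) (C e)) (F (A e) (C e))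
  have hμ : ∀ e, IsProbabilityMeasure (μ e) := fun e =>
    isProbabilityMeasure_pairLaw_smul hρB hF _ _
  have hκ0 : ∀ a b, 0 ≤ l a b * h := fun a b => (mul_pos (hl0 a b) hh0).le
  have hκ1 : ∀ a b, ∀ j : ℕ, j ≤ J → l a b * h * j ≤ 1 := fun a b j hj => by
    have hj' : (j : ℝ) ≤ J := by exact_mod_cast hj
    calc l a b * h * j ≤ l a b * h * J := mul_le_mul_of_nonneg_left hj' (hκ0 a b)
      _ = Λ a b * (1 - δ) * t := by rw [← hJh]; ring
      _ ≤ cdf (F a b) t := hcdf a b t ht.le le_rfl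
      _ ≤ 1 := cdf_le_one _ _
  have hq : ∀ e j, j < J → (μ e).real (H e (j + 1)) ≤ Real.exp (-q e) * (μ e).real (H e j) := by
    intro e j hj
    have := hF (A e) (C e)
    refine pairLaw_real_slowSet_succ_le ?_ ?_ (hFc _ _) (hκ0 _ _) (hκ1 _ _ _ hj)
    · simpa [mul_comm] using (hρB (A e) (C e)).1
    · simpa [mul_comm] using (hρB (A e) (C e)).2
  have hqpair : ∀ w x, q s(w, x) = ρ * (1 - δ) * h * (B (z w) (z x) * Λ (z w) (z x)) := by
    intro w x
    have h1 : q s(w, x) = ρ * (1 - δ) * h * (B (A s(w, x)) (C s(w, x)) *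
        Λ (A s(w, x)) (C s(w, x))) := by
      simp only [q, l, Matrix.smul_apply, smul_eq_mul]
      ring
    rw [h1]
    simp only [A, C]
    rw [apply_inf_sup (f := fun a b => B a b) hBs, apply_inf_sup (f := fun a b => Λ a b) hΛs]
  have hc0 : 0 < ρ * (1 - δ) * h := by positivity
  set η : ℝ := (1 - 3 * δ) * ρ * n * τ * h with hη
  have hη0 : 0 ≤ η := by positivity
  have hηδ : (Fintype.card (Fin n) : ℝ) * η ≤ δ := by
    rw [Fintype.card_fin]
    have : n * η = n * ((1 - 3 * δ) * ρ * n * τ * t) / J := by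
      rw [hη, hh]; ring
    rw [this, div_le_iff₀ hJ0]
    rwa [div_le_iff₀' hδ0] at hJle
  have hrow : ∀ S : Finset (Fin n), (S.card : ℝ) ≤ δ * τ / L * n → ∀ w,
      η ≤ ∑ x ∈ Sᶜ, q s(w, x) := by
    intro S hS w
    let f : Fin k → ℝ := fun b => B (z w) b * Λ (z w) b
    have hf : ∀ b, 0 ≤ f b := fun b => (mul_pos (hB _ _) (hΛ _ _)).le
    -- Balance costs `δ`, and omitting at most `δτn/L` vertices of weight at most `L` costs another
    -- `δτn`. The factor `1 - δ` in the cdf bound brings the total loss to at most `3δ`.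
    have h1 := hz.le_sum hf
    have h2 : τ ≤ ∑ b, π b * f b := (tauMin_le Λ B π (z w)).trans_eq (tau_apply Λ B π (z w))
    have h3 : ∑ x ∈ S, f (z x) ≤ δ * τ * n := by
      calc ∑ x ∈ S, f (z x) ≤ S.card • L := Finset.sum_le_card_nsmul S _ _ fun x _ => hL _ _
        _ = S.card * L := nsmul_eq_mul _ _
        _ ≤ δ * τ / L * n * L := mul_le_mul_of_nonneg_right hS hL0.le
        _ = δ * τ * n := by field_simp
    have h4 := Finset.sum_add_sum_compl S fun x => f (z x)
    have h5 : (1 - 2 * δ) * n * τ ≤ ∑ x ∈ Sᶜ, f (z x) := by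
      have : (1 - δ) * n * τ ≤ (1 - δ) * n * ∑ b, π b * f b :=
        mul_le_mul_of_nonneg_left h2 (by positivity)
      linarith
    simp only [hqpair]
    rw [← Finset.mul_sum]
    refine le_trans ?_ (mul_le_mul_of_nonneg_left h5 hc0.le)
    have h6 : η = ρ * h * (n * τ) * (1 - 3 * δ) := by rw [hη]; ring
    have h7 : ρ * (1 - δ) * h * ((1 - 2 * δ) * n * τ) =
        ρ * h * (n * τ) * ((1 - δ) * (1 - 2 * δ)) := by ring
    rw [h6, h7]
    refine mul_le_mul_of_nonneg_left ?_ (by positivity)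
    nlinarith [sq_nonneg δ]
  have hmin : ∀ e, ρ * (1 - δ) * h * m ≤ q e := fun e => by
    induction e with
    | _ w x =>
      rw [hqpair]
      exact mul_le_mul_of_nonneg_left (hm _ _) hc0.le
  -- The smallness of `β` is used here: a set of `δτn/L` vertices must hit `v` directly with hazard
  -- `2βη`.
  have hK : 2 * β * η ≤ δ * τ / L * n * (ρ * (1 - δ) * h * m) := by
    have h1 : 2 * β ≤ δ * m / L := by rwa [le_div_iff₀ hL0]
    calc 2 * β * η ≤ δ * m / L * η := mul_le_mul_of_nonneg_right h1 hη0
      _ = δ * m / L * (ρ * n * τ * h) * (1 - 3 * δ) := by rw [hη]; ring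
      _ ≤ δ * m / L * (ρ * n * τ * h) * (1 - δ) :=
          mul_le_mul_of_nonneg_left (by linarith) (by positivity)
      _ = δ * τ / L * n * (ρ * (1 - δ) * h * m) := by ring
  refine ⟨missed H v J {u} 0, measurableSet_missed (fun e j => measurableSet_slowSet _ _ _) _ _ _ _,
    ?_, fun g hg => ?_⟩
  · have hmain := measureReal_missed_le_rpow_mul_exp
      (fun e j => measurableSet_slowSet (F (A e) (C e)) (l (A e) (C e) * h) j)
      (fun e => slowSet_zero _ _) (fun e => slowSet_antitone _ (hκ0 _ _)) μ hq hβ0 hβ hη0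
      (by linarith) hηδ hrow (by positivity) hmin hK u v
    have hP : graphLaw (ρ • B) F z = Measure.pi μ := rfl
    rw [hP, ← ofReal_measureReal]
    refine ENNReal.ofReal_le_ofReal (hmain.trans (le_of_eq ?_))
    rw [Fintype.card_fin]
    congr 3
    rw [← hJh, hη]
    ring
  · rw [← hJh]
    refine shortestPathCost_le_of_notMem_missed hh0.le (fun e j y hj hy => ?_) g u v J 0
      (zero_add J) {u} 0 (by simp) ?_ hg
    · exact notMem_slowSet hh0.le hJh.le (hcdf (A e) (C e)) hj hy
    · intro w hw
      rw [Finset.mem_singleton.1 hw, shortestPathCost_self]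
      exact zero_le

/-- Given balanced blocks, the mean number of vertices within distance `t` of a vertex is at most
of order `exp (θ t)`, where `θ` exceeds all the growth rates. -/
theorem exists_card_shortestPathCost_lt_le (hπ : ∀ a, 0 < π a) (hB : ∀ a b, 0 < B a b)
    (hBs : ∀ a b, B a b = B b a)
    (hΛ : ∀ a b, 0 < Λ a b) (hΛs : ∀ a b, Λ a b = Λ b a)
    (hρ : 0 < ρ) (hρB : ∀ a b, 0 ≤ B a b * ρ ∧ B a b * ρ ≤ 1)
    (hF : ∀ a b, IsProbabilityMeasure (F a b))
    (hδ0 : 0 < δ) {A : ℝ} (hA : 0 ≤ A)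
    (hcdf : ∀ a b x, 0 ≤ x → cdf (F a b) x ≤ Λ a b * (1 + δ) * x + A * x ^ 2)
    {θ κ t : ℝ} (hθ : 0 < θ) (hAθ : ∀ a b, 2 * A ≤ δ * Λ a b * θ) (hκ1 : κ < 1)
    (hκ : (1 + δ) * (1 + 2 * δ) * (n * ρ * tauMax Λ B π) ≤ κ * θ)
    (hz : IsBalanced π δ z) (u : Fin n) :
    ∃ W : GraphData n → ℝ≥0∞, Measurable W ∧
      ∫⁻ g, W g ∂graphLaw (ρ • B) F z ≤ ENNReal.ofReal (Real.exp (θ * t) * (1 - κ)⁻¹) ∧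
      ∀ g : GraphData n, Measure.count {v | g.shortestPathCost u v < ENNReal.ofReal t} ≤ W g := by
  let μ : Sym2 (Fin n) → Measure (Bool × ℝ) := fun e =>
    pairLaw ((ρ • B) (z e.inf) (z e.sup)) (F (z e.inf) (z e.sup))
  have hμ : ∀ e, IsProbabilityMeasure (μ e) := fun e =>
    isProbabilityMeasure_pairLaw_smul hρB hF _ _
  have hP : graphLaw (ρ • B) F z = Measure.pi μ := rfl
  have hpair : ∀ a b, ∫⁻ y, edgeWeight θ y ∂pairLaw ((ρ • B) a b) (F a b) ≤
      ENNReal.ofReal (ρ * (1 + 2 * δ) / θ * (B a b * Λ a b)) := by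
    intro a b
    have := hF a b
    have hp0 : 0 ≤ (ρ • B) a b := by simpa [mul_comm] using (hρB a b).1
    refine (lintegral_edgeWeight_le hp0 (A := Λ a b * (1 + δ)) (B := A)
      (by have := hΛ a b; positivity) hA hθ (hcdf a b)).trans (ENNReal.ofReal_le_ofReal ?_)
    -- For large `θ` the quadratic term of the cdf bound is absorbed in one more `δ`.
    have h1 : 2 * A / θ ^ 2 ≤ δ * Λ a b / θ := by
      rw [div_le_div_iff₀ (by positivity) hθ]
      nlinarith [hAθ a b]
    calc (ρ • B) a b * (Λ a b * (1 + δ) / θ + 2 * A / θ ^ 2)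
        ≤ (ρ • B) a b * (Λ a b * (1 + δ) / θ + δ * Λ a b / θ) := by gcongr
      _ = ρ * (1 + 2 * δ) / θ * (B a b * Λ a b) := by
        rw [Matrix.smul_apply, smul_eq_mul]
        ring
  have hκ0 : 0 ≤ κ := by
    have hτ : 0 ≤ tauMax Λ B π := (tau_pos hπ hB hΛ (z u)).le.trans (le_tauMax Λ B π _)
    have : 0 ≤ κ * θ := le_trans (by positivity) hκ
    exact nonneg_of_mul_nonneg_left this hθ
  have hrow : ∀ w, ∑ x, ∫⁻ y, edgeWeight θ y ∂μ s(w, x) ≤ ENNReal.ofReal κ := by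
    intro w
    let f : Fin k → ℝ := fun b => B (z w) b * Λ (z w) b
    have hf : ∀ b, 0 ≤ f b := fun b => (mul_pos (hB _ _) (hΛ _ _)).le
    calc ∑ x, ∫⁻ y, edgeWeight θ y ∂μ s(w, x)
        ≤ ∑ x, ENNReal.ofReal (ρ * (1 + 2 * δ) / θ * f (z x)) := by
          refine Finset.sum_le_sum fun x _ => ?_
          refine (hpair _ _).trans (le_of_eq ?_)
          rw [apply_inf_sup (f := fun a b => B a b) hBs, apply_inf_sup (f := fun a b => Λ a b) hΛs]
      _ = ENNReal.ofReal (ρ * (1 + 2 * δ) / θ * ∑ x, f (z x)) := by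
          rw [Finset.mul_sum, ENNReal.ofReal_sum_of_nonneg]
          intro x _
          have := hf (z x)
          positivity
      _ ≤ ENNReal.ofReal κ := by
          refine ENNReal.ofReal_le_ofReal ?_
          have h1 : ∑ x, f (z x) ≤ (1 + δ) * n * tauMax Λ B π := by
            refine (hz.sum_le hf).trans (mul_le_mul_of_nonneg_left ?_ (by positivity))
            exact (tau_apply Λ B π (z w)).symm.trans_le (le_tauMax Λ B π (z w))
          calc ρ * (1 + 2 * δ) / θ * ∑ x, f (z x)
              ≤ ρ * (1 + 2 * δ) / θ * ((1 + δ) * n * tauMax Λ B π) := by gcongr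
            _ = (1 + δ) * (1 + 2 * δ) * (n * ρ * tauMax Λ B π) / θ := by ring
            _ ≤ κ := by rwa [div_le_iff₀ hθ]
  have hmeas : ∀ m, Measurable fun g : GraphData n => ∑ w, pathSum θ g m {u} u w := fun m =>
    Finset.measurable_sum _ fun w _ => measurable_pathSum θ m _ _ w
  refine ⟨fun g => ENNReal.ofReal (Real.exp (θ * t)) *
    ∑ m ∈ Finset.range n, ∑ w, pathSum θ g m {u} u w,
    measurable_const.mul (Finset.measurable_sum _ fun m _ => hmeas m), ?_, fun g => ?_⟩
  · rw [hP, lintegral_const_mul _ (Finset.measurable_sum _ fun m _ => hmeas m),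
      ENNReal.ofReal_mul (Real.exp_nonneg _), lintegral_finsetSum _ fun m _ => hmeas m]
    refine mul_le_mul_right ?_ _
    calc ∑ m ∈ Finset.range n, ∫⁻ g : GraphData n, ∑ w, pathSum θ g m {u} u w ∂Measure.pi μ
        ≤ ∑ m ∈ Finset.range n, ENNReal.ofReal κ ^ m := Finset.sum_le_sum fun m _ =>
          lintegral_sum_pathSum_le θ μ hrow m {u} u (Finset.mem_singleton_self u)
      _ ≤ ∑' m, ENNReal.ofReal κ ^ m := ENNReal.sum_le_tsum _
      _ = ENNReal.ofReal (1 - κ)⁻¹ := by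
          rw [ENNReal.tsum_geometric, ENNReal.ofReal_inv_of_pos (by linarith),
            ENNReal.ofReal_sub _ hκ0, ENNReal.ofReal_one]
  · classical
    have hset : ({v | g.shortestPathCost u v < ENNReal.ofReal t} : Set (Fin n)) =
        ↑(Finset.univ.filter fun v => g.shortestPathCost u v < ENNReal.ofReal t) := by
      ext; simp
    have hcount : Measure.count {v | g.shortestPathCost u v < ENNReal.ofReal t} =
        ∑ v ∈ Finset.univ.filter fun v => g.shortestPathCost u v < ENNReal.ofReal t,
          (1 : ℝ≥0∞) := by
      rw [hset, Measure.count_apply_finset]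
      simp
    beta_reduce
    rw [hcount, Finset.sum_comm, Finset.mul_sum]
    refine (Finset.sum_le_sum fun v hv => ?_).trans
      (Finset.sum_le_sum_of_subset (Finset.subset_univ _))
    have h3 := exp_le_pathSum_of_shortestPathCost_lt hθ.le g (Finset.mem_filter.1 hv).2
    calc (1 : ℝ≥0∞) = ENNReal.ofReal (Real.exp (θ * t)) * ENNReal.ofReal (Real.exp (-θ * t)) := by
          rw [← ENNReal.ofReal_mul (Real.exp_nonneg _), ← Real.exp_add]
          simp
      _ ≤ _ := mul_le_mul_right h3 _

end FixedBlocks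

/-! ### Averaging over the block assignment and the random vertices. -/

section Mixture

variable {k n : ℕ} {π : Fin k → ℝ} {p : Matrix (Fin k) (Fin k) ℝ} {F : Fin k → Fin k → Measure ℝ}

theorem lintegral_wSBM [hP : ∀ a b, IsProbabilityMeasure (pairLaw (p a b) (F a b))]
    (hπ : ∀ a, 0 ≤ π a) (hsum : ∑ a, π a = 1)
    {f : (Fin n → Fin k) × GraphData n → ℝ≥0∞} (hf : Measurable f) :
    ∫⁻ x, f x ∂wSBM n π p F = ∫⁻ z, ∫⁻ g, f (z, g) ∂graphLaw p F z
      ∂Measure.pi fun _ : Fin n => blockLaw π := by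
  have hG : ∀ z : Fin n → Fin k, IsProbabilityMeasure (graphLaw p F z) := fun z => by
    unfold graphLaw
    infer_instance
  rw [lintegral_fintype (μ := Measure.pi fun _ : Fin n => blockLaw π), wSBM,
    lintegral_finsetSum_measure]
  refine Finset.sum_congr rfl fun z _ => ?_
  rw [lintegral_smul_measure, lintegral_prod _ hf.aemeasurable, lintegral_dirac,
    pi_blockLaw_singleton hπ hsum, smul_eq_mul, mul_comm]

/-- The error made by replacing the failures of `Good` by pairs in `M` and in `N`. -/
theorem one_le_prod_uniformOn_add {A A' : Set (Fin n)} (hA : A.Nonempty) (hA' : A'.Nonempty)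
    {Good M N : Fin n → Fin n → Prop} (h : ∀ u v, M u v ∨ N u v ∨ Good u v) :
    1 ≤ ((uniformOn A).prod (uniformOn A')) {q | Good q.1 q.2} +
      ((∑ u, uniformOn A {u} * ∑ v, uniformOn A' {v} * {v | M u v}.indicator 1 v) +
        ∑ u, uniformOn A {u} * ((Measure.count A')⁻¹ * Measure.count {v | N u v})) := by
  have h1 := isProbabilityMeasure_uniformOn A.toFinite hA
  have h2 := isProbabilityMeasure_uniformOn A'.toFinite hA'
  have hprod : ∀ Q : Fin n → Fin n → Prop, ((uniformOn A).prod (uniformOn A')) {q | Q q.1 q.2} =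
      ∑ u, uniformOn A {u} * uniformOn A' {v | Q u v} := fun Q => by
    rw [Measure.prod_apply (Set.toFinite _).measurableSet, lintegral_fintype]
    exact Finset.sum_congr rfl fun u _ => mul_comm _ _
  calc (1 : ℝ≥0∞) = ((uniformOn A).prod (uniformOn A')) Set.univ := measure_univ.symm
    _ ≤ ((uniformOn A).prod (uniformOn A')) ({q | Good q.1 q.2} ∪
          ({q | M q.1 q.2} ∪ {q | N q.1 q.2})) := by
        refine measure_mono fun q _ => ?_
        rcases h q.1 q.2 with h | h | h
        · exact Or.inr (Or.inl h)
        · exact Or.inr (Or.inr h)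
        · exact Or.inl h
    _ ≤ _ := (measure_union_le _ _).trans (add_le_add le_rfl (measure_union_le _ _))
    _ ≤ _ := by
        refine add_le_add le_rfl (add_le_add ?_ ?_)
        · rw [hprod M]
          refine Finset.sum_le_sum fun u _ => mul_le_mul_right (le_of_eq ?_) _
          rw [← lintegral_indicator_one (Set.toFinite _).measurableSet, lintegral_fintype]
          exact Finset.sum_congr rfl fun v _ => mul_comm _ _
        · rw [hprod N]
          refine Finset.sum_le_sum fun u _ => mul_le_mul_right ?_ _
          rw [uniformOn, cond_apply A'.toFinite.measurableSet]
          exact mul_le_mul_right (measure_mono Set.inter_subset_right) _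

theorem probUniformInBlocks_le_one
    [hP : ∀ a b, IsProbabilityMeasure (pairLaw (p a b) (F a b))]
    (hπ : ∀ a, 0 ≤ π a) (hsum : ∑ a, π a = 1) (a b : Fin k)
    (E : GraphData n → Fin n → Fin n → Prop) : probUniformInBlocks n π p F a b E ≤ 1 := by
  have hG : ∀ z : Fin n → Fin k, IsProbabilityMeasure (graphLaw p F z) := fun z => by
    unfold graphLaw
    infer_instance
  have := isProbabilityMeasure_blockLaw hπ hsum
  calc probUniformInBlocks n π p F a b E ≤ ∫⁻ _x, 1 ∂wSBM n π p F :=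
        lintegral_mono fun x => by
          refine (measure_mono (Set.subset_univ _)).trans ?_
          rw [← Set.univ_prod_univ, Measure.prod_prod]
          exact mul_le_one' prob_le_one prob_le_one
    _ = 1 := by
        rw [lintegral_wSBM hπ hsum measurable_const]
        simp

/-- Bounds that hold given any balanced block assignment carry over to random vertices of the
stochastic block model. -/
theorem one_le_probUniformInBlocks_add
    [hP : ∀ a b, IsProbabilityMeasure (pairLaw (p a b) (F a b))]
    (hπ : ∀ a, 0 < π a) (hsum : ∑ a, π a = 1) (hn : 0 < n) {δ : ℝ} (hδ : δ < 1) (a b : Fin k)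
    {Upper Lower : GraphData n → Fin n → Fin n → Prop} {c₁ c₂ : ℝ≥0∞}
    (hM : ∀ z : Fin n → Fin k, IsBalanced π δ z → ∀ u v : Fin n, ∃ M : Set (GraphData n),
      MeasurableSet M ∧ graphLaw p F z M ≤ c₁ ∧ ∀ g ∉ M, Upper g u v)
    (hW : ∀ z : Fin n → Fin k, IsBalanced π δ z → ∀ u : Fin n, ∃ W : GraphData n → ℝ≥0∞,
      Measurable W ∧ ∫⁻ g, W g ∂graphLaw p F z ≤ c₂ ∧
        ∀ g, Measure.count {v | ¬ Lower g u v} ≤ W g) :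
    1 ≤ probUniformInBlocks n π p F a b (fun g u v => Lower g u v ∧ Upper g u v) +
      (Measure.pi (fun _ : Fin n => blockLaw π) {z | ¬ IsBalanced π δ z} +
        (c₁ + (ENNReal.ofReal ((1 - δ) * (n * π b)))⁻¹ * c₂)) := by
  classical
  have hG : ∀ z : Fin n → Fin k, IsProbabilityMeasure (graphLaw p F z) := fun z => by
    unfold graphLaw
    infer_instance
  have := isProbabilityMeasure_blockLaw (fun a => (hπ a).le) hsum
  choose! M hMm hMc hMU using hM
  choose! W hWm hWc hWL using hW
  let block : (Fin n → Fin k) → Fin k → Set (Fin n) := fun z i => {u | z u = i}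
  have hpos : ∀ i, 0 < (1 - δ) * (n * π i) := fun i => by
    have h1 := hπ i
    have h2 : (0 : ℝ) < n := by exact_mod_cast hn
    have h3 : 0 < 1 - δ := by linarith
    positivity
  have hcount : ∀ z : Fin n → Fin k, ∀ i, Measure.count (block z i) = (blockSize z i : ℝ≥0∞) := by
    intro z i
    have : block z i = ↑(Finset.univ.filter fun x => z x = i) := by ext; simp [block]
    rw [this, Measure.count_apply_finset]
    rfl
  have hsize : ∀ z : Fin n → Fin k, IsBalanced π δ z → ∀ i,
      ENNReal.ofReal ((1 - δ) * (n * π i)) ≤ Measure.count (block z i) := fun z hz i => by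
    rw [hcount, ← ENNReal.ofReal_natCast]
    exact ENNReal.ofReal_le_ofReal (hz i).1
  have hne : ∀ z : Fin n → Fin k, IsBalanced π δ z → ∀ i, (block z i).Nonempty := by
    intro z hz i
    by_contra hcon
    have h := hsize z hz i
    rw [Set.not_nonempty_iff_eq_empty.1 hcon, measure_empty] at h
    exact absurd (ENNReal.ofReal_pos.2 (hpos i)) (not_lt.2 h)
  -- `M` and `W` are measurable, so this majorant can be integrated without measurability of `Upper`
  -- or `Lower`. `M` is averaged over `u` and `v`; `W` counts all bad `v`, whence the division by
  -- the block size.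
  let bad : (Fin n → Fin k) → GraphData n → ℝ≥0∞ := fun z g =>
    (∑ u, uniformOn (block z a) {u} *
      ∑ v, uniformOn (block z b) {v} * (M z u v).indicator 1 g) +
    ∑ u, uniformOn (block z a) {u} * ((Measure.count (block z b))⁻¹ * W z u g)
  have hbad_meas : ∀ z, IsBalanced π δ z → Measurable (bad z) := fun z hz => by
    refine Measurable.add ?_ ?_
    · exact Finset.measurable_sum _ fun u _ => measurable_const.mul
        (Finset.measurable_sum _ fun v _ => measurable_const.mul
          (measurable_one.indicator (hMm z hz u v)))
    · exact Finset.measurable_sum _ fun u _ => measurable_const.mul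
        (measurable_const.mul (hWm z hz u))
  have hbad_int : ∀ z, IsBalanced π δ z → ∫⁻ g, bad z g ∂graphLaw p F z ≤
      c₁ + (ENNReal.ofReal ((1 - δ) * (n * π b)))⁻¹ * c₂ := by
    intro z hz
    have hPa := isProbabilityMeasure_uniformOn (block z a).toFinite (hne z hz a)
    have hPb := isProbabilityMeasure_uniformOn (block z b).toFinite (hne z hz b)
    have hone : ∀ i, IsProbabilityMeasure (uniformOn (block z i)) →
        ∑ u, uniformOn (block z i) {u} = 1 := fun i hi => by
      have h := lintegral_fintype (μ := uniformOn (block z i)) fun _ => 1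
      simpa only [lintegral_const, measure_univ, one_mul] using h.symm
    have hm1 : ∀ u v, Measurable fun g => (M z u v).indicator (1 : GraphData n → ℝ≥0∞) g :=
      fun u v => measurable_one.indicator (hMm z hz u v)
    have hm2 : ∀ u v, Measurable fun g => uniformOn (block z b) {v} *
        (M z u v).indicator (1 : GraphData n → ℝ≥0∞) g := fun u v =>
      measurable_const.mul (hm1 u v)
    have hm3 : ∀ u, Measurable fun g => ∑ v, uniformOn (block z b) {v} *
        (M z u v).indicator (1 : GraphData n → ℝ≥0∞) g := fun u =>
      Finset.measurable_sum _ fun v _ => hm2 u v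
    have hm4 : ∀ u, Measurable fun g => uniformOn (block z a) {u} *
        ∑ v, uniformOn (block z b) {v} * (M z u v).indicator (1 : GraphData n → ℝ≥0∞) g :=
      fun u => measurable_const.mul (hm3 u)
    have hm5 : ∀ u, Measurable fun g => (Measure.count (block z b))⁻¹ * W z u g := fun u =>
      measurable_const.mul (hWm z hz u)
    have hm6 : ∀ u, Measurable fun g => uniformOn (block z a) {u} *
        ((Measure.count (block z b))⁻¹ * W z u g) := fun u => measurable_const.mul (hm5 u)
    simp only [bad]
    rw [lintegral_add_left (Finset.measurable_sum _ fun u _ => hm4 u),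
      lintegral_finsetSum _ fun u _ => hm4 u, lintegral_finsetSum _ fun u _ => hm6 u]
    refine add_le_add ?_ ?_
    · calc ∑ u, ∫⁻ g, uniformOn (block z a) {u} *
            ∑ v, uniformOn (block z b) {v} * (M z u v).indicator 1 g ∂graphLaw p F z
          ≤ ∑ u, uniformOn (block z a) {u} * c₁ := by
            refine Finset.sum_le_sum fun u _ => ?_
            rw [lintegral_const_mul _ (hm3 u)]
            refine mul_le_mul_right ?_ _
            rw [lintegral_finsetSum _ fun v _ => hm2 u v]
            calc ∑ v, ∫⁻ g, uniformOn (block z b) {v} * (M z u v).indicator 1 g ∂graphLaw p F z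
                ≤ ∑ v, uniformOn (block z b) {v} * c₁ := by
                  refine Finset.sum_le_sum fun v _ => ?_
                  rw [lintegral_const_mul _ (hm1 u v), lintegral_indicator_one (hMm z hz u v)]
                  exact mul_le_mul_right (hMc z hz u v) _
              _ = c₁ := by rw [← Finset.sum_mul, hone b hPb, one_mul]
        _ = c₁ := by rw [← Finset.sum_mul, hone a hPa, one_mul]
    · calc ∑ u, ∫⁻ g, uniformOn (block z a) {u} *
            ((Measure.count (block z b))⁻¹ * W z u g) ∂graphLaw p F z
          ≤ ∑ u, uniformOn (block z a) {u} *
              ((ENNReal.ofReal ((1 - δ) * (n * π b)))⁻¹ * c₂) := by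
            refine Finset.sum_le_sum fun u _ => ?_
            rw [lintegral_const_mul _ (hm5 u), lintegral_const_mul _ (hWm z hz u)]
            exact mul_le_mul_right (mul_le_mul' (ENNReal.inv_le_inv.2 (hsize z hz b))
              (hWc z hz u)) _
        _ = _ := by rw [← Finset.sum_mul, hone a hPa, one_mul]
  let err : (Fin n → Fin k) × GraphData n → ℝ≥0∞ := fun x =>
    if IsBalanced π δ x.1 then bad x.1 x.2 else 1
  have herr_meas : Measurable err := by
    refine measurable_from_prod_countable_right fun z => ?_
    by_cases hz : IsBalanced π δ z
    · simpa [err, hz] using hbad_meas z hz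
    · simp [err, hz]
  have hpoint : ∀ x : (Fin n → Fin k) × GraphData n,
      1 ≤ ((uniformOn {u | x.1 u = a}).prod (uniformOn {v | x.1 v = b}))
        {q | Lower x.2 q.1 q.2 ∧ Upper x.2 q.1 q.2} + err x := by
    rintro ⟨z, g⟩
    by_cases hz : IsBalanced π δ z
    · refine (one_le_prod_uniformOn_add (M := fun u v => g ∈ M z u v)
        (N := fun u v => ¬ Lower g u v) (Good := fun u v => Lower g u v ∧ Upper g u v)
        (hne z hz a) (hne z hz b) fun u v => ?_).trans ?_
      · by_cases h1 : g ∈ M z u v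
        · exact Or.inl h1
        · have := hMU z hz u v g h1
          tauto
      · refine add_le_add le_rfl ?_
        simp only [err, hz, if_true, bad]
        refine add_le_add (le_of_eq ?_) ?_
        · refine Finset.sum_congr rfl fun u _ => ?_
          congr 1
        · exact Finset.sum_le_sum fun u _ => mul_le_mul_right
            (mul_le_mul_right (hWL z hz u g) _) _
    · simp [err, hz]
  have hint : ∫⁻ x, err x ∂wSBM n π p F ≤
      Measure.pi (fun _ : Fin n => blockLaw π) {z | ¬ IsBalanced π δ z} +
        (c₁ + (ENNReal.ofReal ((1 - δ) * (n * π b)))⁻¹ * c₂) := by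
    rw [lintegral_wSBM (fun a => (hπ a).le) hsum herr_meas]
    calc ∫⁻ z, ∫⁻ g, err (z, g) ∂graphLaw p F z ∂(Measure.pi fun _ : Fin n => blockLaw π)
        ≤ ∫⁻ z, ({z | ¬ IsBalanced π δ z}.indicator 1 z +
            (c₁ + (ENNReal.ofReal ((1 - δ) * (n * π b)))⁻¹ * c₂))
            ∂Measure.pi fun _ : Fin n => blockLaw π := by
          refine lintegral_mono fun z => ?_
          by_cases hz : IsBalanced π δ z
          · simpa [err, hz] using hbad_int z hz
          · simp [err, hz]
      _ = _ := by
          rw [lintegral_add_right _ measurable_const,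
            lintegral_indicator_one (Set.toFinite _).measurableSet]
          simp
  have htotal : ∫⁻ _x, (1 : ℝ≥0∞) ∂wSBM n π p F = 1 := by
    rw [lintegral_wSBM (fun a => (hπ a).le) hsum measurable_const]
    simp
  calc (1 : ℝ≥0∞) = ∫⁻ _x, (1 : ℝ≥0∞) ∂wSBM n π p F := htotal.symm
    _ ≤ _ := lintegral_mono hpoint
    _ = probUniformInBlocks n π p F a b (fun g u v => Lower g u v ∧ Upper g u v) +
          ∫⁻ x, err x ∂wSBM n π p F := lintegral_add_right _ herr_meas
    _ ≤ _ := add_le_add le_rfl hint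

end Mixture

/-! ### Consequences of `ρ_n = ω(log n / n)`. -/

section Asymptotics

theorem tendsto_two_mul_rpow_mul_exp {β s c : ℝ} (hs : 0 < s) {x : ℕ → ℝ}
    (hx : ∀ᶠ n : ℕ in atTop, (β + s) * Real.log n ≤ x n) :
    Tendsto (fun n : ℕ => ENNReal.ofReal (c * (n : ℝ) ^ β * Real.exp (-x n))) atTop (𝓝 0) := by
  have hlim : Tendsto (fun n : ℕ => ENNReal.ofReal (|c| * (n : ℝ) ^ (-s))) atTop (𝓝 0) := by
    rw [← ENNReal.ofReal_zero, ← mul_zero |c|]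
    exact ENNReal.tendsto_ofReal (tendsto_const_nhds.mul
      ((tendsto_rpow_neg_atTop hs).comp tendsto_natCast_atTop_atTop))
  refine tendsto_of_tendsto_of_tendsto_of_le_of_le' tendsto_const_nhds hlim
    (Eventually.of_forall fun _ => zero_le) ?_
  filter_upwards [hx, eventually_gt_atTop 0] with n hxn hn
  have hn' : (0 : ℝ) < n := by exact_mod_cast hn
  refine ENNReal.ofReal_le_ofReal ?_
  rw [mul_assoc]
  refine mul_le_mul (le_abs_self c) ?_ (by positivity) (abs_nonneg c)
  rw [Real.rpow_def_of_pos hn', Real.rpow_def_of_pos hn', ← Real.exp_add]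
  refine Real.exp_le_exp.2 ?_
  linarith

variable {ρ : ℕ → ℝ}

theorem tendsto_log_div_mul (hρ : (fun n : ℕ => Real.log n / n) =o[atTop] ρ) :
    Tendsto (fun n : ℕ => Real.log n / (n * ρ n)) atTop (𝓝 0) := by
  simpa only [div_div] using hρ.tendsto_div_nhds_zero

/-- For `n ≥ 2` the quantity `log n / n` is positive, so its domination by `ρ` excludes `ρ n = 0`.
-/
theorem eventually_pos_of_isLittleO (hρ : (fun n : ℕ => Real.log n / n) =o[atTop] ρ)
    (hρ0 : ∀ n, 0 ≤ ρ n) : ∀ᶠ n in atTop, 0 < ρ n := by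
  filter_upwards [hρ.bound one_pos, eventually_ge_atTop 2] with n hn hn2
  refine (hρ0 n).lt_of_ne fun h => ?_
  have hn' : (2 : ℝ) ≤ n := by exact_mod_cast hn2
  have hlog : 0 < Real.log n := Real.log_pos (by linarith)
  rw [← h, norm_zero, mul_zero, Real.norm_eq_abs, abs_of_pos (by positivity)] at hn
  exact absurd (div_pos hlog (by linarith)) (not_lt.2 hn)

theorem tendsto_mul_atTop_of_isLittleO (hρ : (fun n : ℕ => Real.log n / n) =o[atTop] ρ)
    (hρ0 : ∀ n, 0 ≤ ρ n) : Tendsto (fun n : ℕ => n * ρ n) atTop atTop := by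
  refine tendsto_atTop_mono' _ ?_ (Real.tendsto_log_atTop.comp tendsto_natCast_atTop_atTop)
  filter_upwards [hρ.bound one_pos, eventually_ge_atTop 2] with n hn hn2
  have hn' : (2 : ℝ) ≤ n := by exact_mod_cast hn2
  have hlog : 0 < Real.log n := Real.log_pos (by linarith)
  rw [one_mul, Real.norm_eq_abs, Real.norm_eq_abs, abs_of_nonneg (hρ0 n),
    abs_of_nonneg (by positivity), div_le_iff₀ (by linarith)] at hn
  simp only [Function.comp_apply]
  linarith

end Asymptotics

end WSBM

/-! ### Choice of the constants and conclusion. -/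

theorem proposition1 {k : ℕ}
    -- block probabilities
    (π : Fin k → ℝ) (hπ_pos : ∀ a, 0 < π a) (hπ_sum : ∑ a, π a = 1)
    -- edge probabilities `p_ab = B_ab ρ_n` with `ρ_n = ω(log n / n)`
    (B : Matrix (Fin k) (Fin k) ℝ) (hB_symm : B.IsSymm) (hB_pos : ∀ a b, 0 < B a b)
    (ρ : ℕ → ℝ) (hρ_prob : ∀ n a b, 0 ≤ B a b * ρ n ∧ B a b * ρ n ≤ 1)
    (hρ : (fun n : ℕ => Real.log n / n) =o[atTop] ρ)
    -- cost distributions, with cdf `F_ab` continuous, `F_ab(0) = 0` and `F_ab'(0) = λ_ab > 0`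
    (F : Fin k → Fin k → Measure ℝ) (hF_prob : ∀ a b, IsProbabilityMeasure (F a b))
    (hF_symm : ∀ a b, F a b = F b a) (hF_cont : ∀ a b, Continuous (cdf (F a b)))
    (Λ : Matrix (Fin k) (Fin k) ℝ) (hΛ_pos : ∀ a b, 0 < Λ a b)
    (hF_zero : ∀ a b, cdf (F a b) 0 = 0)
    (hF_deriv : ∀ a b, HasDerivWithinAt (cdf (F a b)) (Λ a b) (Set.Ici 0) 0)
    (a b : Fin k) (ε : ℝ) (hε : 0 < ε) :
    Tendsto
      (fun n : ℕ => WSBM.probUniformInBlocks n π (ρ n • B) F a b fun g u v =>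
        ENNReal.ofReal ((1 - ε) * (WSBM.tauMax Λ B π)⁻¹)
            ≤ ENNReal.ofReal (n * ρ n / Real.log n) * g.shortestPathCost u v ∧
        ENNReal.ofReal (n * ρ n / Real.log n) * g.shortestPathCost u v
            ≤ ENNReal.ofReal ((1 + ε) * (WSBM.tauMin Λ B π)⁻¹))
      atTop (𝓝 1) := by
  have : Nonempty (Fin k) := ⟨a⟩
  set τ₀ := WSBM.tauMin Λ B π with hτ₀
  set τ₁ := WSBM.tauMax Λ B π with hτ₁
  have hτ₀_pos : 0 < τ₀ := WSBM.tauMin_pos hπ_pos hB_pos hΛ_pos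
  have hτ₁_pos : 0 < τ₁ := WSBM.tauMax_pos hπ_pos hB_pos hΛ_pos
  have hBs : ∀ i j, B i j = B j i := fun i j => hB_symm.apply j i
  -- `Λ` inherits the symmetry of `F` because right derivatives are unique.
  have hΛs : ∀ i j, Λ i j = Λ j i := fun i j => by
    have h := hF_deriv i j
    rw [hF_symm i j] at h
    exact (uniqueDiffWithinAt_Ici (0 : ℝ)).eq_deriv _ h (hF_deriv j i)
  have hρ0 : ∀ n, 0 ≤ ρ n := fun n => nonneg_of_mul_nonneg_right (hρ_prob n a b).1 (hB_pos a b)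
  -- Small enough for `(1+δ)(1+2δ) ≤ 1 + ε/2` and `(1+ε/2)(1+δ) ≤ (1-3δ)(1+ε)`, the losses of the
  -- lower and the upper bound.
  set δ : ℝ := ε / (10 * (1 + ε)) with hδ_def
  have hδ0 : 0 < δ := by positivity
  have hδ1 : δ ≤ 1 / 10 := by
    rw [hδ_def, div_le_div_iff₀ (by positivity) (by norm_num)]
    linarith
  have hδε : δ * (1 + ε) = ε / 10 := by rw [hδ_def]; field_simp
  obtain ⟨r, hr0, hr⟩ := WSBM.exists_cdf_bounds (D := fun i : Fin k × Fin k => F i.1 i.2)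
    (l := fun i => Λ i.1 i.2) (fun i => hΛ_pos i.1 i.2) hδ0 (fun i => hF_zero i.1 i.2)
    fun i => hF_deriv i.1 i.2
  let BΛ : Fin k × Fin k → ℝ := fun i => B i.1 i.2 * Λ i.1 i.2
  have hBΛ : ∀ i, 0 < BΛ i := fun i => mul_pos (hB_pos _ _) (hΛ_pos _ _)
  obtain ⟨iL, hL⟩ := Finite.exists_max BΛ
  obtain ⟨im, hm⟩ := Finite.exists_min BΛ
  obtain ⟨iΛ, hΛm⟩ := Finite.exists_min fun i : Fin k × Fin k => Λ i.1 i.2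
  set β : ℝ := min (1 / 2) (δ * BΛ im / (2 * BΛ iL)) with hβ_def
  have hβ0 : 0 < β := lt_min (by norm_num)
    (div_pos (mul_pos hδ0 (hBΛ im)) (mul_pos two_pos (hBΛ iL)))
  have hβm : 2 * β * BΛ iL ≤ δ * BΛ im := by
    have h := min_le_right (1 / 2) (δ * BΛ im / (2 * BΛ iL))
    rw [← hβ_def, le_div_iff₀ (mul_pos two_pos (hBΛ iL))] at h
    linarith
  set κ : ℝ := (1 + ε / 2) / (1 + ε) with hκ_def
  have hκ1 : κ < 1 := by
    rw [hκ_def, div_lt_one (by positivity)]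
    linarith
  let x : ℕ → ℝ := fun n => Real.log n / (n * ρ n)
  let t : ℕ → ℝ := fun n => (1 + ε) * τ₀⁻¹ * x n
  let t' : ℕ → ℝ := fun n => (1 - ε) * τ₁⁻¹ * x n
  -- The product `θ n * t' n` is `(1 - ε²) log n`, and the extra factor `1 + ε` leaves room for `κ <
  -- 1`.
  let θ : ℕ → ℝ := fun n => (1 + ε) * τ₁ * (n * ρ n)
  let c₁ : ℕ → ℝ≥0∞ := fun n => ENNReal.ofReal (2 * (n : ℝ) ^ β *
    Real.exp (-(β * ((1 - 3 * δ) * ρ n * n * τ₀ * t n) / (1 + δ))))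
  let c₂ : ℕ → ℝ≥0∞ := fun n => ENNReal.ofReal (Real.exp (θ n * t' n) * (1 - κ)⁻¹)
  have hx_lim : Tendsto x atTop (𝓝 0) := WSBM.tendsto_log_div_mul hρ
  have ht_lim : Tendsto t atTop (𝓝 0) := by
    simpa using hx_lim.const_mul ((1 + ε) * τ₀⁻¹)
  have hθ_lim : Tendsto θ atTop atTop :=
    (WSBM.tendsto_mul_atTop_of_isLittleO hρ hρ0).const_mul_atTop (by positivity)
  have hρ_pos := WSBM.eventually_pos_of_isLittleO hρ hρ0
  have hP : ∀ n i j, IsProbabilityMeasure (WSBM.pairLaw ((ρ n • B) i j) (F i j)) := fun n i j =>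
    WSBM.isProbabilityMeasure_pairLaw_smul (hρ_prob n) hF_prob i j
  have hcancel : ∀ n : ℕ, 2 ≤ n → 0 < ρ n → n * ρ n * x n = Real.log n := fun n hn hρn => by
    have hn' : (2 : ℝ) ≤ n := by exact_mod_cast hn
    have : (n : ℝ) ≠ 0 := by linarith
    simp only [x]
    field_simp
  have hmain : ∀ᶠ n : ℕ in atTop,
      1 ≤ WSBM.probUniformInBlocks n π (ρ n • B) F a b (fun g u v =>
        ENNReal.ofReal ((1 - ε) * τ₁⁻¹)
            ≤ ENNReal.ofReal (n * ρ n / Real.log n) * g.shortestPathCost u v ∧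
        ENNReal.ofReal (n * ρ n / Real.log n) * g.shortestPathCost u v
            ≤ ENNReal.ofReal ((1 + ε) * τ₀⁻¹)) +
        (Measure.pi (fun _ : Fin n => WSBM.blockLaw π) {z | ¬ WSBM.IsBalanced π δ z} +
          (c₁ n + (ENNReal.ofReal ((1 - δ) * (n * π b)))⁻¹ * c₂ n)) := by
    filter_upwards [eventually_ge_atTop 2, hρ_pos, ht_lim.eventually (ge_mem_nhds hr0),
      hθ_lim.eventually_ge_atTop (2 * (r⁻¹) ^ 2 / (δ * Λ iΛ.1 iΛ.2))] with n hn hρn htn hθn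
    have hn' : (2 : ℝ) ≤ n := by exact_mod_cast hn
    have hlog : 0 < Real.log n := Real.log_pos (by linarith)
    have hn0 : (0 : ℝ) < n := by linarith
    have hx_pos : 0 < x n := by simp only [x]; positivity
    have ht_pos : 0 < t n := by simp only [t]; positivity
    have hθ_pos : 0 < θ n := by simp only [θ]; positivity
    have hcoef : 0 < n * ρ n / Real.log n := by positivity
    have hcx : n * ρ n / Real.log n * x n = 1 := by
      simp only [x]
      field_simp
    refine WSBM.one_le_probUniformInBlocks_add hπ_pos hπ_sum (by omega) (by linarith) a b
      (fun z hz u v => ?_) (fun z hz u => ?_)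
    · obtain ⟨M, hMm, hMc, hM⟩ := WSBM.exists_event_shortestPathCost_le hB_pos hBs hΛ_pos hΛs hρn
        (hρ_prob n) hF_prob hF_cont hτ₀_pos hδ0 hδ1 ht_pos
        (fun i j y hy0 hyt => (hr (i, j)).1 y hy0 (hyt.trans htn)) (fun i j => hL (i, j))
        (hBΛ iL) (fun i j => hm (i, j)) (hBΛ im) hβ0 (min_le_left _ _) hβm hz u v
      refine ⟨M, hMm, hMc, fun g hg => (mul_le_mul_right (hM g hg) _).trans (le_of_eq ?_)⟩
      rw [← ENNReal.ofReal_mul hcoef.le]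
      congr 1
      simp only [t]
      linear_combination (1 + ε) * τ₀⁻¹ * hcx
    · have hAθ : ∀ i j, 2 * (r⁻¹) ^ 2 ≤ δ * Λ i j * θ n := fun i j => by
        have h1 : Λ iΛ.1 iΛ.2 ≤ Λ i j := hΛm (i, j)
        have h2 := hΛ_pos iΛ.1 iΛ.2
        rw [div_le_iff₀ (by positivity)] at hθn
        have h3 : δ * Λ iΛ.1 iΛ.2 * θ n ≤ δ * Λ i j * θ n := by gcongr
        linarith
      have hκθ : (1 + δ) * (1 + 2 * δ) * (n * ρ n * τ₁) ≤ κ * θ n := by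
        have h1 : (1 + δ) * (1 + 2 * δ) ≤ 1 + ε / 2 := by nlinarith
        have h2 : κ * θ n = (1 + ε / 2) * (n * ρ n * τ₁) := by
          simp only [θ, hκ_def]
          field_simp
        rw [h2]
        exact mul_le_mul_of_nonneg_right h1 (by positivity)
      obtain ⟨W, hWm, hWc, hW⟩ := WSBM.exists_card_shortestPathCost_lt_le (t := t' n) hπ_pos hB_pos
        hBs hΛ_pos hΛs hρn (hρ_prob n) hF_prob hδ0 (A := (r⁻¹) ^ 2) (by positivity)
        (fun i j y hy0 => (hr (i, j)).2 y hy0) hθ_pos hAθ hκ1 hκθ hz u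
      refine ⟨W, hWm, hWc, fun g => (measure_mono fun v hv => ?_).trans (hW g)⟩
      simp only [Set.mem_ofPred_eq, not_le] at hv ⊢
      by_contra! hcon
      refine absurd hv (not_lt.2 (le_trans (le_of_eq ?_) (mul_le_mul_right hcon _)))
      rw [← ENNReal.ofReal_mul hcoef.le]
      congr 1
      simp only [t']
      linear_combination -((1 - ε) * τ₁⁻¹ * hcx)
  have hc₁ : Tendsto c₁ atTop (𝓝 0) := by
    -- The exponential is at most `n^(-β(1+ε/2))`, which beats `n^β`.
    refine WSBM.tendsto_two_mul_rpow_mul_exp (s := β * (ε / 2)) (by positivity) ?_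
    filter_upwards [eventually_ge_atTop 2, hρ_pos] with n hn hρn
    have hn' : (2 : ℝ) ≤ n := by exact_mod_cast hn
    have hlog : 0 < Real.log n := Real.log_pos (by linarith)
    have h1 : (1 - 3 * δ) * ρ n * n * τ₀ * t n = (1 - 3 * δ) * (1 + ε) * Real.log n := by
      have h2 : τ₀ * τ₀⁻¹ = 1 := mul_inv_cancel₀ hτ₀_pos.ne'
      rw [← hcancel n hn hρn]
      simp only [t]
      linear_combination (1 - 3 * δ) * ρ n * n * (1 + ε) * x n * h2
    rw [h1, le_div_iff₀ (by positivity)]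
    have h3 : (1 + ε / 2) * (1 + δ) ≤ (1 - 3 * δ) * (1 + ε) := by nlinarith
    have h4 := mul_le_mul_of_nonneg_left h3 (mul_pos hβ0 hlog).le
    linarith
  have hc₂ : Tendsto (fun n : ℕ => (ENNReal.ofReal ((1 - δ) * (n * π b)))⁻¹ * c₂ n) atTop
      (𝓝 0) := by
    -- The block size contributes `n⁻¹` against `n^(1-ε²)` close vertices, leaving `n^(-ε²)`.
    have hlim := WSBM.tendsto_two_mul_rpow_mul_exp (β := -1) (s := ε ^ 2)
      (c := (1 - κ)⁻¹ * ((1 - δ) * π b)⁻¹) (x := fun n => -(θ n * t' n)) (by positivity) (by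
        filter_upwards [eventually_ge_atTop 2, hρ_pos] with n hn hρn
        have h2 : τ₁ * τ₁⁻¹ = 1 := mul_inv_cancel₀ hτ₁_pos.ne'
        rw [← hcancel n hn hρn]
        simp only [t', θ]
        refine le_of_eq ?_
        linear_combination (1 + ε) * (1 - ε) * n * ρ n * x n * h2)
    refine hlim.congr' ?_
    filter_upwards [eventually_ge_atTop 2] with n hn
    have hn' : (2 : ℝ) ≤ n := by exact_mod_cast hn
    have hb := hπ_pos b
    have h1δ : 0 < 1 - δ := by linarith
    have hn0 : (0 : ℝ) < n := by linarith
    simp only [c₂]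
    rw [← ENNReal.ofReal_inv_of_pos (by positivity), ← ENNReal.ofReal_mul (by positivity),
      Real.rpow_neg_one, neg_neg]
    congr 1
    rw [mul_inv, mul_inv, mul_inv]
    ring
  have herr := (WSBM.tendsto_measure_not_isBalanced hπ_pos hπ_sum hδ0).add (hc₁.add hc₂)
  have hlow := ENNReal.Tendsto.sub (tendsto_const_nhds (x := (1 : ℝ≥0∞))) herr
    (Or.inl ENNReal.one_ne_top)
  simp only [add_zero, tsub_zero] at hlow
  refine tendsto_of_tendsto_of_tendsto_of_le_of_le' hlow tendsto_const_nhds ?_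
    (Eventually.of_forall fun n =>
      WSBM.probUniformInBlocks_le_one (fun i => (hπ_pos i).le) hπ_sum a b _)
  filter_upwards [hmain] with n hn
  exact tsub_le_iff_right.2 hn
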